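/- All rings are associative and unital, and ring homomorphisms preserve units. For parallel ring homomorphisms $\alpha,\beta:A\to B$ let $\mathrm{Hom}(\alpha,\beta)=\{t\in B: t\alpha(a)=\beta(a)t\ \forall a\in A\}$ and $\mathrm{End}\,\alpha=\mathrm{Hom}(\alpha,\alpha)$, a subring of $B$. Write $\alpha\le\beta$ if there are finitely many $b_i\in\mathrm{Hom}(\alpha,\beta)$, $a_i\in\mathrm{Hom}(\beta,\alpha)$ with $\sum_i a_ib_i=1_B$. A homomorphism $\lambda:A\to B$ is left adjoint to $\rho:B\to A$ (in the 2-category $\mathsf{Ring}$) if there are $e\in\mathrm{Hom}(\lambda\rho,\mathrm{id}_B)$ and $m\in\mathrm{Hom}(\mathrm{id}_A,\rho\lambda)$ with $\rho(e)m=1_A$ and $e\lambda(m)=1_B$; then $\rho$ is called right adjoint. A right bialgebroid over a ring $R$ is a ring $H$ with ring homomorphisms $s:R\to H$, $t:R^{op}\to H$ with commuting images and, for the bimodule structure $r\cdot h\cdot r'=h\,s(r')t(r)$, an $R$-coring structure given by $R$-$R$-bimodule maps $\Delta:H\to H\otimes_RH$, $h\mapsto h_{(1)}\otimes h_{(2)}$,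 and $\varepsilon:H\to R$ (coassociative and counital) such that $s(r)h_{(1)}\otimes h_{(2)}=h_{(1)}\otimes t(r)h_{(2)}$, $\Delta(1)=1\otimes 1$, $\Delta(gh)=\Delta(g)\Delta(h)$, $\varepsilon(1)=1$ and $\varepsilon(gh)=\varepsilon(s(\varepsilon(g))h)=\varepsilon(t(\varepsilon(g))h)$ for all $g,h\in H$, $r\in R$. It is left finite projective if $_RH$ is finitely generated projective. A right $H$-comodule algebra is a ring $A$ with a ring homomorphism $\pi:R\to A$ and a coassociative, counital, right $R$-linear map $\delta:A\to A\otimes_RH$, $a\mapsto a_{(0)}\otimes a_{(1)}$ (where $a\cdot r=a\pi(r)$), such that $\pi(r)a_{(0)}\otimes a_{(1)}=a_{(0)}\otimes t(r)a_{(1)}$, $\delta(1)=1\otimes1$ and $\delta(aa')=\delta(a)\delta(a')$. A ring homomorphism $\rho:B\to A$ is right $H$-Galois, with respect to such a structure on $A$, if $\{a\in A:\delta(a)=a\otimes1\}=\rho(B)$ and the map $A\otimes_BA\to A\otimes_RH$, $a\otimes a'\mapsto aa'_{(0)}\otimes a'_{(1)}$, is bijective. **Corollary.** For a ring homomorphism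 $\rho:B\to A$ the following conditions are equivalent: 1. There are a left finite projective right bialgebroid $H$ over $R=\mathrm{End}\,\rho$ and a right $H$-comodule algebra structure on $A$ with respect to which $\rho$ is right $H$-Galois, and ${}_BA\cong{}_BB$ as left $B$-modules, where $B$ acts on $A$ through $\rho$. 2. Condition 1 holds with a comodule algebra structure for which $\pi:R\to A$ is the inclusion $\mathrm{End}\,\rho\subseteq A$. 3. $\rho$ has a left adjoint $\lambda$ with $\rho\lambda\rho\le\rho$. 4. $\rho$ has a left adjoint, and $\rho\lambda\rho\le\rho$ for every left adjoint $\lambda$ of $\rho$. -/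

import Mathlib

open scoped TensorProduct

universe u v w

/-! ### The 2-category of rings -/

section TwoCategory

variable {A : Type u} {B : Type v} [Ring A] [Ring B]

/-- `t ∈ B` is a 2-cell `α ⟶ β`, i.e. `t α(a) = β(a) t` for all `a`. Vertical composition of 2-cells is
multiplication in `B`. -/
def IsIntertwiner (α β : A →+* B) (t : B) : Prop :=
  ∀ a : A, t * α a = β a * t

/-- The ring `End ρ` of 2-cells `ρ ⟶ ρ`, a subring of the target of `ρ`. -/
def endRing (ρ : A →+* B) : Subring B where
  carrier := {t | IsIntertwiner ρ ρ t}
  mul_mem' := by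
    intro x y hx hy a
    rw [mul_assoc, hy a, ← mul_assoc, hx a, mul_assoc]
  one_mem' := fun a => by rw [one_mul, mul_one]
  add_mem' := by
    intro x y hx hy a
    rw [add_mul, mul_add, hx a, hy a]
  zero_mem' := fun a => by rw [zero_mul, mul_zero]
  neg_mem' := by
    intro x hx a
    rw [neg_mul, mul_neg, hx a]

/-- `λ ⊣ ρ` in the 2-category of rings: there are 2-cells `e : λρ ⟶ id_B` and `m : id_A ⟶ ρλ` satisfying
the triangle identities. -/
def IsLeftAdjoint (lam : A →+* B) (ρ : B →+* A) : Prop :=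
  ∃ (e : B) (m : A),
    IsIntertwiner (lam.comp ρ) (RingHom.id B) e ∧
    IsIntertwiner (RingHom.id A) (ρ.comp lam) m ∧
    ρ e * m = 1 ∧ e * lam m = 1

/-- The preorder `ρ ≤ σ` on parallel ring homomorphisms: there is a direct summand diagram
`ρ --bᵢ--> σ --aᵢ--> ρ` with `∑ aᵢ bᵢ = 1`. -/
def IsSummandOf (ρ σ : A →+* B) : Prop :=
  ∃ (n : ℕ) (a b : Fin n → B),
    (∀ i, IsIntertwiner ρ σ (b i)) ∧ (∀ i, IsIntertwiner σ ρ (a i)) ∧ ∑ i, a i * b i = 1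

/-- `ρ : A → B` is left regular: `B` with the left `A`-action `a · b = ρ(a) b` is isomorphic to the
left regular `A`-module. -/
def IsLeftRegularHom (ρ : A →+* B) : Prop :=
  ∃ f : A ≃+ B, ∀ a x : A, f (a * x) = ρ a * f x

end TwoCategory

/-! ### Tensor products over a noncommutative ring -/

section BalTensor

/-- The subgroup of `M ⊗ N` generated by all `m·r ⊗ n - m ⊗ r·n`. -/
def balancedRel {R M N : Type*} [AddCommGroup M] [AddCommGroup N]
    (f : R → M →+ M) (g : R → N →+ N) : AddSubgroup (M ⊗[ℤ] N) :=
  AddSubgroup.closure {z | ∃ (r : R) (m : M) (n : N), z = f r m ⊗ₜ[ℤ] n - m ⊗ₜ[ℤ] g r n}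

/-- The tensor product `M ⊗_R N` of a right `R`-module `M` and a left `R`-module `N`, where
`m · r = f r m` and `r · n = g r n`. -/
def BalTensor {R M N : Type*} [AddCommGroup M] [AddCommGroup N]
    (f : R → M →+ M) (g : R → N →+ N) : Type _ :=
  (M ⊗[ℤ] N) ⧸ balancedRel f g

namespace BalTensor

variable {R M N M' N' P S : Type*} [AddCommGroup M] [AddCommGroup N] [AddCommGroup M']
  [AddCommGroup N'] [AddCommGroup P] [AddCommGroup S]

instance instAddCommGroup (f : R → M →+ M) (g : R → N →+ N) : AddCommGroup (BalTensor f g) :=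
  inferInstanceAs (AddCommGroup ((M ⊗[ℤ] N) ⧸ balancedRel f g))

/-- The quotient map `M ⊗ N → M ⊗_R N`. -/
def proj (f : R → M →+ M) (g : R → N →+ N) : M ⊗[ℤ] N →+ BalTensor f g :=
  QuotientAddGroup.mk' (balancedRel f g)

/-- The balanced biadditive map `(m, n) ↦ m ⊗ n`. -/
def mk (f : R → M →+ M) (g : R → N →+ N) : M →+ N →+ BalTensor f g :=
  AddMonoidHom.mk' (fun m =>
    AddMonoidHom.mk' (fun n => proj f g (m ⊗ₜ[ℤ] n))
      (fun n n' => by rw [TensorProduct.tmul_add, map_add]))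
    (fun m m' => by
      ext n
      simp [TensorProduct.add_tmul])

theorem mk_balanced (f : R → M →+ M) (g : R → N →+ N) (r : R) (m : M) (n : N) :
    mk f g (f r m) n = mk f g m (g r n) := by
  refine (QuotientAddGroup.eq_iff_sub_mem).2 ?_
  exact AddSubgroup.subset_closure ⟨r, m, n, rfl⟩

variable {f : R → M →+ M} {g : R → N →+ N} {f' : R → M' →+ M'} {g' : R → N' →+ N'}

/-- The universal property of `M ⊗_R N`. -/
def lift (φ : M →+ N →+ P) (h : ∀ r m n, φ (f r m) n = φ m (g r n)) : BalTensor f g →+ P :=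
  QuotientAddGroup.lift (balancedRel f g)
    (TensorProduct.liftAddHom φ (fun k m n => by
      rw [map_zsmul, map_zsmul, AddMonoidHom.coe_smul, Pi.smul_apply]))
    (by
      refine (AddSubgroup.closure_le _).2 ?_
      rintro _ ⟨r, m, n, rfl⟩
      simp [h r m n])

@[simp]
theorem lift_mk (φ : M →+ N →+ P) (h : ∀ r m n, φ (f r m) n = φ m (g r n)) (m : M) (n : N) :
    lift (f := f) (g := g) φ h (mk f g m n) = φ m n := rfl

theorem hom_ext {φ ψ : BalTensor f g →+ P} (h : ∀ m n, φ (mk f g m n) = ψ (mk f g m n)) :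
    φ = ψ := by
  refine QuotientAddGroup.addMonoidHom_ext _ ?_
  ext z
  induction z using TensorProduct.induction_on with
  | zero => rw [map_zero, map_zero]
  | tmul m n => exact h m n
  | add x y hx hy => rw [map_add, map_add, hx, hy]

/-- `φ ⊗ ψ` for a right `R`-linear `φ` and a left `R`-linear `ψ`. -/
def map (φ : M →+ M') (ψ : N →+ N') (hφ : ∀ r m, φ (f r m) = f' r (φ m))
    (hψ : ∀ r n, ψ (g r n) = g' r (ψ n)) : BalTensor f g →+ BalTensor f' g' :=
  lift (((mk f' g').compl₂ ψ).comp φ)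
    (fun r m n => by
      change mk f' g' (φ (f r m)) (ψ n) = mk f' g' (φ m) (ψ (g r n))
      rw [hφ, hψ, mk_balanced])

@[simp]
theorem map_mk (φ : M →+ M') (ψ : N →+ N') (hφ : ∀ r m, φ (f r m) = f' r (φ m))
    (hψ : ∀ r n, ψ (g r n) = g' r (ψ n)) (m : M) (n : N) :
    map (f := f) (g := g) (f' := f') (g' := g') φ ψ hφ hψ (mk f g m n) = mk f' g' (φ m) (ψ n) := rfl

/-- The right `R`-action on `M ⊗_R N` induced by a right `R`-action `k` on the bimodule `N`. -/
def rightAct (f : R → M →+ M) (g k : R → N →+ N) (hgk : ∀ r r' n, k r' (g r n) = g r (k r' n)) :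
    R → BalTensor f g →+ BalTensor f g :=
  fun r' => map (AddMonoidHom.id M) (k r') (fun _ _ => rfl) (fun r n => hgk r r' n)

/-- The left `R`-action on `N ⊗_R S` induced by a left `R`-action `g` on the bimodule `N`. -/
def leftAct (g k : R → N →+ N) (l : R → S →+ S) (hgk : ∀ r r' n, k r' (g r n) = g r (k r' n)) :
    R → BalTensor k l →+ BalTensor k l :=
  fun r => map (g r) (AddMonoidHom.id S) (fun r' n => (hgk r r' n).symm) (fun _ _ => rfl)

/-- The map `(m ⊗ n) ↦ (z ↦ m ⊗ (n ⊗ z))`. -/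
def assocAux (f : R → M →+ M) (g k : R → N →+ N) (l : R → S →+ S)
    (hgk : ∀ r r' n, k r' (g r n) = g r (k r' n)) :
    BalTensor f g →+ S →+ BalTensor f (leftAct g k l hgk) :=
  lift
    (AddMonoidHom.mk' (fun m =>
        AddMonoidHom.mk' (fun n => (mk f (leftAct g k l hgk) m).comp (mk k l n))
          (fun n n' => by ext z; simp))
      (fun m m' => by ext n z; simp))
    (fun r m n => by
      ext z
      exact mk_balanced f (leftAct g k l hgk) r m (mk k l n z))

/-- The associativity map `(M ⊗_R N) ⊗_R S → M ⊗_R (N ⊗_R S)`, `(m ⊗ n) ⊗ z ↦ m ⊗ (n ⊗ z)`. -/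
def assoc (f : R → M →+ M) (g k : R → N →+ N) (l : R → S →+ S)
    (hgk : ∀ r r' n, k r' (g r n) = g r (k r' n)) :
    BalTensor (rightAct f g k hgk) l →+ BalTensor f (leftAct g k l hgk) :=
  lift (assocAux f g k l hgk)
    (fun r x z => by
      have key : ((assocAux f g k l hgk).flip z).comp (rightAct f g k hgk r) =
          (assocAux f g k l hgk).flip (l r z) :=
        hom_ext fun m n => congrArg (mk f (leftAct g k l hgk) m) (mk_balanced k l r n z)
      exact DFunLike.congr_fun key x)

end BalTensor

end BalTensor

/-! ### The Takeuchi product -/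

section Takeuchi

variable {R P Q : Type*} [Ring P] [Ring Q]

/-- `P ⊗_R Q` for rings `P`, `Q` with right `R`-action `x · r = x p(r)` on `P` and left `R`-action
`r · y = y q(r)` on `Q`. -/
abbrev RingTensor (p : R → P) (q : R → Q) : Type _ :=
  BalTensor (fun r => AddMonoidHom.mulRight (p r)) (fun r => AddMonoidHom.mulRight (q r))

namespace RingTensor

/-- The element `x ⊗ y` of `P ⊗_R Q`. -/
abbrev tmul (p : R → P) (q : R → Q) (x : P) (y : Q) : RingTensor p q :=
  BalTensor.mk (fun r => AddMonoidHom.mulRight (p r)) (fun r => AddMonoidHom.mulRight (q r)) x y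

/-- Factorwise left multiplication `x' ⊗ y' ↦ x x' ⊗ y y'`, biadditive in `(x, y)`. -/
def lmul (p : R → P) (q : R → Q) : P →+ Q →+ (RingTensor p q →+ RingTensor p q) :=
  AddMonoidHom.mk' (fun x =>
    AddMonoidHom.mk' (fun y =>
        BalTensor.map (AddMonoidHom.mulLeft x) (AddMonoidHom.mulLeft y)
          (fun r x' => (mul_assoc x x' (p r)).symm) (fun r y' => (mul_assoc y y' (q r)).symm))
      (fun y y' => BalTensor.hom_ext fun a b => by
        change tmul p q (x * a) ((y + y') * b) = tmul p q (x * a) (y * b) + tmul p q (x * a) (y' * b)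
        simp only [tmul, add_mul, map_add]))
    (fun x x' => by
      ext1 y
      exact BalTensor.hom_ext fun a b => by
        change tmul p q ((x + x') * a) (y * b) = tmul p q (x * a) (y * b) + tmul p q (x' * a) (y * b)
        simp only [tmul, add_mul, map_add, AddMonoidHom.add_apply])

theorem lmul_tmul (p : R → P) (q : R → Q) (x x' : P) (y y' : Q) :
    lmul p q x y (tmul p q x' y') = tmul p q (x * x') (y * y') := rfl

theorem lmul_mul (p : R → P) (q : R → Q) (x x' : P) (y y' : Q) (z : RingTensor p q) :
    lmul p q (x * x') (y * y') z = lmul p q x y (lmul p q x' y' z) := by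
  have h : lmul p q (x * x') (y * y') = (lmul p q x y).comp (lmul p q x' y') :=
    BalTensor.hom_ext fun a b => by
      change tmul p q (x * x' * a) (y * y' * b) = tmul p q (x * (x' * a)) (y * (y' * b))
      rw [mul_assoc, mul_assoc]
  rw [h, AddMonoidHom.comp_apply]

/-- The Takeuchi product `P ×_R Q`: all `∑ xᵢ ⊗ yᵢ` with `∑ p(r) xᵢ ⊗ yᵢ = ∑ xᵢ ⊗ q(r) yᵢ`
for every `r`. -/
def takeuchi (p : R → P) (q : R → Q) : AddSubgroup (RingTensor p q) where
  carrier := {z | ∀ r : R, lmul p q (p r) 1 z = lmul p q 1 (q r) z}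
  add_mem' := by
    intro z z' hz hz' r
    rw [map_add, map_add, hz r, hz' r]
  zero_mem' := fun r => by rw [map_zero, map_zero]
  neg_mem' := by
    intro z hz r
    rw [map_neg, map_neg, hz r]

/-- The factorwise product `(∑ xᵢ ⊗ yᵢ) (∑ xⱼ' ⊗ yⱼ') = ∑ xᵢ xⱼ' ⊗ yᵢ yⱼ'`, which is well defined as
soon as the second factor lies in the Takeuchi product. -/
def takeuchiMul (p : R → P) (q : R → Q) :
    RingTensor p q →+ takeuchi p q →+ RingTensor p q :=
  BalTensor.lift
    (AddMonoidHom.mk' (fun x =>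
        AddMonoidHom.mk' (fun y => (lmul p q x y).comp (takeuchi p q).subtype)
          (fun y y' => by ext z; simp))
      (fun x x' => by ext y z; simp))
    (fun r x y => by
      ext ⟨z, hz⟩
      change lmul p q (x * p r) y z = lmul p q x (y * q r) z
      have h1 := lmul_mul p q x (p r) y 1 z
      have h2 := lmul_mul p q x 1 y (q r) z
      rw [mul_one] at h1 h2
      rw [h1, h2, hz r])

end RingTensor

end Takeuchi

/-! ### Right bialgebroids -/

/-- A ring `H` with a source map `s : R → H` and a target map `t : Rᵒᵖ → H` whose images commute.
It is an `R`-`R`-bimodule by `r · h · r' = h s(r') t(r)`. -/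
structure SourceTarget (R : Type u) [Ring R] (H : Type v) [Ring H] where
  s : R →+* H
  t : Rᵐᵒᵖ →+* H
  comm : ∀ (r : R) (r' : Rᵐᵒᵖ), s r * t r' = t r' * s r

namespace SourceTarget

variable {R : Type u} [Ring R] {H : Type v} [Ring H] (E : SourceTarget R H)
  {P : Type w} [Ring P] (p : R →+* P)

/-- The target map as a function on `R`. -/
def tgt (r : R) : H := E.t (MulOpposite.op r)

/-- `P ⊗_R H` for an `R`-ring `p : R → P`, with respect to `x · r = x p(r)` and `r · h = h t(r)`.
For `p = s` this is `H ⊗_R H`. -/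
abbrev Tensor : Type _ := RingTensor p E.tgt

/-- The element `x ⊗ h` of `P ⊗_R H`. -/
abbrev tmul (x : P) (h : H) : E.Tensor p := RingTensor.tmul p E.tgt x h

theorem act_comm (r r' : R) (h : H) :
    AddMonoidHom.mulRight (E.s r') (AddMonoidHom.mulRight (E.tgt r) h) =
      AddMonoidHom.mulRight (E.tgt r) (AddMonoidHom.mulRight (E.s r') h) := by
  simp only [AddMonoidHom.mulRight_apply, mul_assoc, tgt, E.comm]

/-- The right `R`-action `(x ⊗ h) · r = x ⊗ h s(r)` on `P ⊗_R H`. -/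
def ract : R → E.Tensor p →+ E.Tensor p :=
  BalTensor.rightAct (fun r => AddMonoidHom.mulRight (p r)) (fun r => AddMonoidHom.mulRight (E.tgt r))
    (fun r => AddMonoidHom.mulRight (E.s r)) E.act_comm

/-- The left `R`-action `r · (h ⊗ h') = h t(r) ⊗ h'` on `H ⊗_R H`. -/
def lact : R → E.Tensor E.s →+ E.Tensor E.s :=
  BalTensor.leftAct (fun r => AddMonoidHom.mulRight (E.tgt r)) (fun r => AddMonoidHom.mulRight (E.s r))
    (fun r => AddMonoidHom.mulRight (E.tgt r)) E.act_comm

/-- `P ⊗_R (H ⊗_R H)`. -/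
abbrev Tensor₃ : Type _ := BalTensor (fun r => AddMonoidHom.mulRight (p r)) E.lact

/-- The left `R`-module `_R H`, with `r · h = h t(r)`. -/
abbrev leftModule : Module R H where
  smul r h := h * E.tgt r
  one_smul h := by
    change h * E.t 1 = h
    rw [map_one, mul_one]
  mul_smul r r' h := by
    change h * E.t (MulOpposite.op r' * MulOpposite.op r) = h * E.t _ * E.t _
    rw [map_mul, mul_assoc]
  smul_zero r := zero_mul _
  smul_add r h h' := add_mul _ _ _
  add_smul r r' h := by
    change h * E.t (MulOpposite.op r + MulOpposite.op r') = h * E.t _ + h * E.t _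
    rw [map_add, mul_add]
  zero_smul h := by
    change h * E.t 0 = 0
    rw [map_zero, mul_zero]

/-- `_R H` is finitely generated projective. -/
def IsLeftFiniteProjective : Prop :=
  letI := E.leftModule
  Module.Finite R H ∧ Module.Projective R H

end SourceTarget

/-- A comultiplication `Δ : H → H ⊗_R H` and a counit `ε : H → R`, both `R`-`R`-bimodule maps. -/
structure RightCoringData (R : Type u) [Ring R] (H : Type v) [Ring H] extends SourceTarget R H where
  comul : H →+ toSourceTarget.Tensor s
  counit : H →+ R
  comul_left : ∀ (r : R) (h : H), comul (h * toSourceTarget.tgt r) = toSourceTarget.lact r (comul h)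
  comul_right : ∀ (r : R) (h : H), comul (h * s r) = toSourceTarget.ract s r (comul h)
  counit_left : ∀ (r : R) (h : H), counit (h * toSourceTarget.tgt r) = r * counit h
  counit_right : ∀ (r : R) (h : H), counit (h * s r) = counit h * r

namespace RightCoringData

variable {R : Type u} [Ring R] {H : Type v} [Ring H] (C : RightCoringData R H)
  {P : Type w} [Ring P] (p : R →+* P)

/-- `id ⊗ ε : P ⊗_R H → P`, `x ⊗ h ↦ x p(ε(h))`. -/
def idCounit : C.Tensor p →+ P :=
  BalTensor.lift
    (AddMonoidHom.mk' (fun x => (AddMonoidHom.mulLeft x).comp ((p : R →+ P).comp C.counit))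
      (fun x x' => by ext h; simp [add_mul]))
    (fun r x h => by
      change x * p r * p (C.counit h) = x * p (C.counit (h * C.tgt r))
      rw [C.counit_left, map_mul, mul_assoc])

/-- `ε ⊗ id : H ⊗_R H → H`, `h ⊗ h' ↦ h' t(ε(h))`. -/
def counitId : C.Tensor C.s →+ H :=
  BalTensor.lift
    (AddMonoidHom.mk' (fun h => AddMonoidHom.mulRight (C.tgt (C.counit h)))
      (fun h h' => by
        ext x
        change x * C.t (MulOpposite.op (C.counit (h + h'))) = x * C.t _ + x * C.t _
        rw [map_add, MulOpposite.op_add, map_add, mul_add]))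
    (fun r h h' => by
      change h' * C.t (MulOpposite.op (C.counit (h * C.s r))) = h' * C.t _ * C.t _
      rw [C.counit_right, MulOpposite.op_mul, map_mul, mul_assoc])

/-- `id ⊗ Δ : P ⊗_R H → P ⊗_R (H ⊗_R H)`. -/
def idComul : C.Tensor p →+ C.Tensor₃ p :=
  BalTensor.map (AddMonoidHom.id P) C.comul (fun _ _ => rfl) (fun r h => C.comul_left r h)

/-- `δ ⊗ id : P ⊗_R H → (P ⊗_R H) ⊗_R H = P ⊗_R (H ⊗_R H)` for a right `R`-linear
`δ : P → P ⊗_R H`. -/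
def coactId (δ : P →+ C.Tensor p) (hδ : ∀ (r : R) (x : P), δ (x * p r) = C.ract p r (δ x)) :
    C.Tensor p →+ C.Tensor₃ p :=
  (BalTensor.assoc (fun r => AddMonoidHom.mulRight (p r)) (fun r => AddMonoidHom.mulRight (C.tgt r))
    (fun r => AddMonoidHom.mulRight (C.s r)) (fun r => AddMonoidHom.mulRight (C.tgt r))
    C.act_comm).comp
  (BalTensor.map δ (AddMonoidHom.id H) (fun r x => hδ r x) (fun _ _ => rfl))

end RightCoringData

/-- A right bialgebroid over `R`. -/
structure RightBialgebroid (R : Type u) [Ring R] (H : Type v) [Ring H] extends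
    RightCoringData R H where
  coassoc : ∀ h : H, toRightCoringData.coactId s comul comul_right (comul h) =
    toRightCoringData.idComul s (comul h)
  counit_id_comul : ∀ h : H, toRightCoringData.counitId (comul h) = h
  id_counit_comul : ∀ h : H, toRightCoringData.idCounit s (comul h) = h
  comul_mem : ∀ h : H, comul h ∈ RingTensor.takeuchi s toSourceTarget.tgt
  comul_one : comul 1 = toSourceTarget.tmul s 1 1
  comul_mul : ∀ g h : H, comul (g * h) =
    RingTensor.takeuchiMul s toSourceTarget.tgt (comul g) ⟨comul h, comul_mem h⟩
  counit_one : counit 1 = 1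
  counit_mul_s : ∀ g h : H, counit (g * h) = counit (s (counit g) * h)
  counit_mul_t : ∀ g h : H, counit (g * h) = counit (toSourceTarget.tgt (counit g) * h)

/-! ### Comodule algebras and Galois extensions -/

/-- The structure of a right `H`-comodule algebra on a ring `A`: an `R`-ring structure `π : R → A` and a
coassociative counital coaction `δ : A → A ⊗_R H`, where `a · r = a π(r)`, which is right `R`-linear and
unital, has values in the Takeuchi product `A ×_R H`, and is multiplicative. -/
structure RightComoduleAlgebra {R : Type u} [Ring R] {H : Type v} [Ring H]
    (𝓗 : RightBialgebroid R H) (A : Type w) [Ring A] where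
  π : R →+* A
  δ : A →+ 𝓗.Tensor π
  δ_right : ∀ (r : R) (a : A), δ (a * π r) = 𝓗.ract π r (δ a)
  coassoc : ∀ a : A, 𝓗.coactId π δ δ_right (δ a) = 𝓗.idComul π (δ a)
  counit : ∀ a : A, 𝓗.idCounit π (δ a) = a
  δ_mem : ∀ a : A, δ a ∈ RingTensor.takeuchi π 𝓗.tgt
  δ_one : δ 1 = 𝓗.tmul π 1 1
  δ_mul : ∀ a a' : A, δ (a * a') = RingTensor.takeuchiMul π 𝓗.tgt (δ a) ⟨δ a', δ_mem a'⟩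

namespace RightComoduleAlgebra

variable {R : Type u} [Ring R] {H : Type v} [Ring H] {𝓗 : RightBialgebroid R H}
  {A : Type w} [Ring A] (𝓐 : RightComoduleAlgebra 𝓗 A)

/-- `a` is a coinvariant: `δ(a) = a ⊗ 1`. -/
def IsCoinvariant (a : A) : Prop := 𝓐.δ a = 𝓗.tmul 𝓐.π a 1

variable {B : Type*} [Ring B] (ρ : B →+* A)

/-- `A ⊗_B A` with respect to `a · b = a ρ(b)` and `b · a = ρ(b) a`. -/
abbrev SelfTensor : Type _ :=
  BalTensor (fun b => AddMonoidHom.mulRight (ρ b)) (fun b => AddMonoidHom.mulLeft (ρ b))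

/-- The Galois map `Γ : A ⊗_B A → A ⊗_R H`, `a ⊗ a' ↦ a a'₍₀₎ ⊗ a'₍₁₎`, when `ρ(B)` consists of
coinvariants. -/
def galoisMap (hρ : ∀ b : B, 𝓐.IsCoinvariant (ρ b)) : SelfTensor ρ →+ 𝓗.Tensor 𝓐.π :=
  BalTensor.lift
    (AddMonoidHom.mk' (fun a => (RingTensor.lmul 𝓐.π 𝓗.tgt a 1).comp 𝓐.δ)
      (fun a a' => by ext x; simp))
    (fun b a a' => by
      change RingTensor.lmul 𝓐.π 𝓗.tgt (a * ρ b) 1 (𝓐.δ a') =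
        RingTensor.lmul 𝓐.π 𝓗.tgt a 1 (𝓐.δ (ρ b * a'))
      have h1 := RingTensor.lmul_mul 𝓐.π 𝓗.tgt a (ρ b) 1 1 (𝓐.δ a')
      rw [mul_one] at h1
      rw [𝓐.δ_mul, hρ b, h1]
      rfl)

/-- `ρ : B → A` is right `H`-Galois with respect to the given comodule algebra structure: the coinvariants
are precisely `ρ(B)` and the Galois map is bijective. -/
def IsGalois : Prop :=
  ∃ hρ : ∀ b : B, 𝓐.IsCoinvariant (ρ b),
    (∀ a : A, 𝓐.IsCoinvariant a → a ∈ ρ.range) ∧ Function.Bijective (𝓐.galoisMap ρ hρ)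

end RightComoduleAlgebra

/-! A left adjoint `λ` of `ρ` exists exactly when `_B A` is free on one generator, the unit `m`. The
adjunction then identifies `A ⊗_B A` with `A` through `a ⊗ a' ↦ a ρ(e λ(a'))`, with inverse `a ↦ a ⊗
m`, and the right `B`-action becomes the one through `ρλρ`. If `ρ` is Galois, a dual basis of `_R H`
also makes `A ⊗_R H` an `A`-`B`-bimodule summand of a power of `A`, with `B` acting through `ρ`.
Comparing both sides of the Galois map gives `ρλρ ≤ ρ`
(`RightComoduleAlgebra.IsGalois.isSummandOf`).

Conversely, `Q = ρλ` is a monad on `A` with multiplication `E = ρ(e)` and unit `m`. Put `H = (End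
Q)ᵒᵖ` over `R = End ρ`, with the inclusion as target map and mates as source map. The summand
diagram for `ρλρ ≤ ρ` yields a dual basis of `_R H` (`sum_basis_coord`). Its coordinate maps factor
through evaluation maps from the tensor products to `A`, which are therefore injective
(`evalA_injective`, `evalH_injective` and their triple versions). After evaluation `Δ(h)` is `h E`
and `δ(a)` is `E Q(a)`, so the axioms become monad laws and naturality in `A`, and the Galois map
becomes the isomorphism `A ⊗_B A ≅ A` above.

The choice of `λ` is immaterial because two left adjoints are compared by invertible 2-cells, of
which a one-sided inverse suffices. -/

/-! ### Left adjoints in the 2-category of rings -/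

section Adjoint

variable {A : Type v} {B : Type u} [Ring A] [Ring B] {ρ : B →+* A}

/-- If `_B A` is free on one generator, then `ρ` has a left adjoint. -/
theorem IsLeftRegularHom.exists_isLeftAdjoint (h : IsLeftRegularHom ρ) :
    ∃ lam : A →+* B, IsLeftAdjoint lam ρ := by
  obtain ⟨f, hf⟩ := h
  have hf1 : ∀ b, f b = ρ b * f 1 := fun b => by rw [← hf, mul_one]
  -- Freeness on `f 1`: every identity in `B` below is checked after applying `ρ` and multiplying by
  -- `f 1`.
  have hinj : ∀ b b', ρ b * f 1 = ρ b' * f 1 → b = b' := fun b b' hb =>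
    f.injective (by rw [hf1, hf1 b', hb])
  have hsymm : ∀ a, ρ (f.symm a) * f 1 = a := fun a => by rw [← hf1, f.apply_symm_apply]
  let lam : A →+* B :=
    { toFun := fun a => f.symm (f 1 * a)
      map_one' := by simp
      map_zero' := by simp
      map_add' := fun a a' => by rw [mul_add, map_add]
      map_mul' := fun a a' => hinj _ _ (by
        rw [map_mul ρ, hsymm, mul_assoc, hsymm, ← mul_assoc, ← mul_assoc, hsymm]) }
  have hlam : ∀ a, ρ (lam a) * f 1 = f 1 * a := fun a => hsymm _
  refine ⟨lam, f.symm 1, f 1, fun b => hinj _ _ ?_, fun a => (hlam a).symm, hsymm 1,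
    hinj _ _ ?_⟩
  · change ρ (f.symm 1 * lam (ρ b)) * f 1 = ρ (b * f.symm 1) * f 1
    rw [map_mul, mul_assoc, hlam, ← mul_assoc, hsymm, one_mul, map_mul, mul_assoc, hsymm, mul_one]
  · rw [map_mul, mul_assoc, hlam, ← mul_assoc, hsymm, one_mul, map_one ρ, one_mul]

/-- If `ρ` has a left adjoint, then `_B A` is free on the unit of the adjunction. -/
theorem IsLeftAdjoint.isLeftRegularHom {lam : A →+* B} (h : IsLeftAdjoint lam ρ) :
    IsLeftRegularHom ρ := by
  obtain ⟨e, m, he, hm, h1, h2⟩ := h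
  refine ⟨⟨⟨fun b => ρ b * m, fun a => e * lam a, fun b => ?_, fun a => ?_⟩, fun b b' => ?_⟩,
    fun b b' => ?_⟩
  · have := he b
    simp only [RingHom.comp_apply, RingHom.id_apply] at this
    simp only [map_mul]
    rw [← mul_assoc, this, mul_assoc, h2, mul_one]
  · have := hm a
    simp only [RingHom.comp_apply, RingHom.id_apply] at this
    simp only [map_mul]
    rw [mul_assoc, ← this, ← mul_assoc, h1, one_mul]
  · simp [add_mul]
  · simp [mul_assoc]

/-- A left adjoint is unique up to a comparison 2-cell with a left inverse. -/
theorem IsLeftAdjoint.exists_comparison {lam lam' : A →+* B} (h : IsLeftAdjoint lam ρ)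
    (h' : IsLeftAdjoint lam' ρ) :
    ∃ p q : B, IsIntertwiner lam lam' p ∧ IsIntertwiner lam' lam q ∧ p * q = 1 := by
  obtain ⟨e, m, he, hm, h1, h2⟩ := h
  obtain ⟨e', m', he', hm', h1', h2'⟩ := h'
  simp only [IsIntertwiner, RingHom.comp_apply, RingHom.id_apply] at he hm he' hm'
  -- The mates of the identity of `ρ` under the two adjunctions.
  refine ⟨e * lam m', e' * lam' m, fun a => ?_, fun a => ?_, ?_⟩
  · rw [mul_assoc, ← map_mul, hm', map_mul, ← mul_assoc, he, mul_assoc]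
  · rw [mul_assoc, ← map_mul, hm, map_mul, ← mul_assoc, he', mul_assoc]
  · calc e * lam m' * (e' * lam' m) = e * (lam m' * e') * lam' m := by simp only [mul_assoc]
      _ = e' * lam' (ρ (e * lam m')) * lam' m := by rw [he']; simp only [mul_assoc]
      _ = e' * lam' (ρ e * (ρ (lam m') * m)) := by simp only [map_mul, mul_assoc]
      _ = 1 := by rw [← hm, ← mul_assoc, h1, one_mul, h2']

/-- Whiskering the comparison cells by `ρ` on both sides makes `ρ lam' ρ` a retract of `ρ lam ρ`, so
a summand diagram for the latter restricts to one for the former. -/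
theorem IsSummandOf.of_isLeftAdjoint {lam lam' : A →+* B} (h : IsLeftAdjoint lam ρ)
    (h' : IsLeftAdjoint lam' ρ) (hs : IsSummandOf ((ρ.comp lam).comp ρ) ρ) :
    IsSummandOf ((ρ.comp lam').comp ρ) ρ := by
  obtain ⟨p, q, hp, hq, hpq⟩ := h.exists_comparison h'
  obtain ⟨n, a, b, hb, ha, hab⟩ := hs
  simp only [IsIntertwiner, RingHom.comp_apply] at hp hq hb ha
  refine ⟨n, fun i => ρ p * a i, fun i => b i * ρ q, fun i x => ?_, fun i x => ?_, ?_⟩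
  · change b i * ρ q * ρ (lam' (ρ x)) = ρ x * (b i * ρ q)
    rw [mul_assoc, ← map_mul, hq, map_mul, ← mul_assoc, hb, mul_assoc]
  · change ρ p * a i * ρ x = ρ (lam' (ρ x)) * (ρ p * a i)
    rw [mul_assoc, ha, ← mul_assoc, ← map_mul, hp, map_mul, mul_assoc]
  · calc ∑ i, ρ p * a i * (b i * ρ q) = ρ p * (∑ i, a i * b i) * ρ q := by
          simp only [Finset.mul_sum, Finset.sum_mul, mul_assoc]
      _ = 1 := by rw [hab, mul_one, ← map_mul, hpq, map_one]

end Adjoint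

/-! ### Dual bases -/

namespace SourceTarget

variable {R : Type*} [Ring R] {H : Type*} [Ring H] {S : SourceTarget R H} {P : Type*} [Ring P]
  {n : ℕ} {x : Fin n → H} {φ : Fin n → H →+ R}

/-- If `_R H` is finitely generated projective, it has a finite dual basis. -/
theorem IsLeftFiniteProjective.exists_dualBasis
    (h : S.IsLeftFiniteProjective) :
    ∃ (n : ℕ) (x : Fin n → H) (φ : Fin n → H →+ R),
      (∀ i r y, φ i (y * S.tgt r) = r * φ i y) ∧ ∀ y, ∑ i, x i * S.tgt (φ i y) = y := by
  let _ := S.leftModule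
  obtain ⟨hfin, hproj⟩ := h
  obtain ⟨n, f, g, -, -, hfg⟩ := Module.Finite.exists_comp_eq_id_of_projective R H
  refine ⟨n, fun i => f (Pi.single i 1), fun i =>
    ((LinearMap.proj i : (Fin n → R) →ₗ[R] R).comp g).toAddMonoidHom, fun i r y => ?_, fun y => ?_⟩
  · exact ((LinearMap.proj i : (Fin n → R) →ₗ[R] R).comp g).map_smul r y
  · have hy : f (g y) = y := LinearMap.congr_fun hfg y
    conv_rhs => rw [← hy, pi_eq_sum_univ' (g y), map_sum]
    refine Finset.sum_congr rfl fun i _ => ?_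
    rw [map_smul]
    change f _ * _ = f _ * _
    congr 2

theorem isLeftFiniteProjective_of_dualBasis (hφ : ∀ i r y, φ i (y * S.tgt r) = r * φ i y)
    (hx : ∀ y, ∑ i, x i * S.tgt (φ i y) = y) : S.IsLeftFiniteProjective := by
  let _ := S.leftModule
  let f : (Fin n → R) →ₗ[R] H := Fintype.linearCombination R x
  let g : H →ₗ[R] (Fin n → R) := LinearMap.pi fun i =>
    { toFun := φ i
      map_add' := map_add (φ i)
      map_smul' := hφ i }
  have hfg : f ∘ₗ g = LinearMap.id := LinearMap.ext fun y => hx y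
  exact ⟨Module.Finite.of_surjective f fun y => ⟨g y, LinearMap.congr_fun hfg y⟩,
    Module.Projective.of_split g f hfg⟩

/-- The map `a ⊗ h ↦ a p(φ(h))` induced by a left `R`-linear functional `φ` on `H`. -/
def coordMap (S : SourceTarget R H) (p : R →+* P) (φ : H →+ R)
    (hφ : ∀ r y, φ (y * S.tgt r) = r * φ y) : S.Tensor p →+ P :=
  BalTensor.lift
    (AddMonoidHom.mk' (fun a => (AddMonoidHom.mulLeft a).comp ((p : R →+ P).comp φ))
      (fun a a' => by ext; simp [add_mul]))
    (fun r a h => by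
      change a * p r * p (φ h) = a * p (φ (h * S.tgt r))
      rw [hφ, map_mul, mul_assoc])

/-- The dual basis formula moves the scalar `φ i h` across the tensor sign. Hence `P ⊗_R H` is a
summand of `Pⁿ`, and its elements are determined by their coordinates. -/
theorem sum_coordMap (p : R →+* P) (hφ : ∀ i r y, φ i (y * S.tgt r) = r * φ i y)
    (hx : ∀ y, ∑ i, x i * S.tgt (φ i y) = y) (z : S.Tensor p) :
    ∑ i, S.tmul p (S.coordMap p (φ i) (hφ i) z) (x i) = z := by
  have key : ∑ i, ((BalTensor.mk _ _).flip (x i)).comp (S.coordMap p (φ i) (hφ i)) =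
      AddMonoidHom.id (S.Tensor p) := BalTensor.hom_ext fun a h => by
    rw [AddMonoidHom.finsetSum_apply, AddMonoidHom.id_apply]
    calc ∑ i, S.tmul p (a * p (φ i h)) (x i)
        = ∑ i, S.tmul p a (x i * S.tgt (φ i h)) :=
          Finset.sum_congr rfl fun i _ => BalTensor.mk_balanced _ _ (φ i h) a (x i)
      _ = S.tmul p a h := by rw [← map_sum, hx]
  have := DFunLike.congr_fun key z
  rwa [AddMonoidHom.finsetSum_apply] at this

theorem tensor_ext (p : R →+* P) (hφ : ∀ i r y, φ i (y * S.tgt r) = r * φ i y)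
    (hx : ∀ y, ∑ i, x i * S.tgt (φ i y) = y) {z z' : S.Tensor p}
    (h : ∀ i, S.coordMap p (φ i) (hφ i) z = S.coordMap p (φ i) (hφ i) z') : z = z' := by
  rw [← sum_coordMap p hφ hx z, ← sum_coordMap p hφ hx z']
  exact Finset.sum_congr rfl fun i _ => by rw [h i]

/-- The map `a ⊗ (h ⊗ h') ↦ a ⊗ h s(φ(h'))` induced by a left `R`-linear functional `φ` on `H`. -/
def coordMap₃ (S : SourceTarget R H) (p : R →+* P) (φ : H →+ R)
    (hφ : ∀ r y, φ (y * S.tgt r) = r * φ y) : S.Tensor₃ p →+ S.Tensor p :=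
  BalTensor.map (AddMonoidHom.id P) (S.coordMap S.s φ hφ) (fun _ _ => rfl) (fun r w =>
    DFunLike.congr_fun (show (S.coordMap S.s φ hφ).comp (S.lact r) =
        (AddMonoidHom.mulRight (S.tgt r)).comp (S.coordMap S.s φ hφ) from
      BalTensor.hom_ext fun h h' => (S.act_comm r (φ h') h)) w)

/-- Only the last tensor factor is expanded in the dual basis; the remaining coordinates live in `P
⊗_R H`. -/
theorem tensor₃_ext (p : R →+* P) (hφ : ∀ i r y, φ i (y * S.tgt r) = r * φ i y)
    (hx : ∀ y, ∑ i, x i * S.tgt (φ i y) = y) {z z' : S.Tensor₃ p}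
    (h : ∀ i, S.coordMap₃ p (φ i) (hφ i) z = S.coordMap₃ p (φ i) (hφ i) z') : z = z' := by
  let ins : Fin n → S.Tensor p →+ S.Tensor₃ p := fun i =>
    BalTensor.map (AddMonoidHom.id P) ((BalTensor.mk _ _).flip (x i)) (fun _ _ => rfl)
      (fun _ _ => rfl)
  have key : ∑ i, (ins i).comp (S.coordMap₃ p (φ i) (hφ i)) = AddMonoidHom.id (S.Tensor₃ p) :=
    BalTensor.hom_ext fun a w => by
      rw [AddMonoidHom.finsetSum_apply, AddMonoidHom.id_apply]
      change ∑ i, BalTensor.mk _ S.lact a (S.tmul S.s (S.coordMap S.s (φ i) (hφ i) w) (x i)) = _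
      rw [← map_sum, sum_coordMap S.s hφ hx]
  have hz := DFunLike.congr_fun key z
  have hz' := DFunLike.congr_fun key z'
  rw [AddMonoidHom.finsetSum_apply, AddMonoidHom.id_apply] at hz hz'
  rw [← hz, ← hz']
  exact Finset.sum_congr rfl fun i _ => congrArg (ins i) (h i)

end SourceTarget

/-! ### Galois extensions have depth two -/

section Galois

variable {R : Type*} [Ring R] {H : Type*} [Ring H] {𝓗 : RightBialgebroid R H}
  {A : Type v} [Ring A] (𝓐 : RightComoduleAlgebra 𝓗 A) {B : Type u} [Ring B] {ρ : B →+* A}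

/-- The image of `π` commutes with the coinvariants. -/
theorem RightComoduleAlgebra.IsCoinvariant.commute_π {𝓐 : RightComoduleAlgebra 𝓗 A} {a : A}
    (ha : 𝓐.IsCoinvariant a) (r : R) : 𝓐.π r * a = a * 𝓐.π r := by
  have h := 𝓐.δ_mem a r
  rw [ha] at h
  -- The Takeuchi condition for `a ⊗ 1` reads `π(r) a ⊗ 1 = a ⊗ t(r)`; apply `id ⊗ ε` and use
  -- `ε(t(r)) = r`.
  have h' := congrArg (𝓗.idCounit 𝓐.π) h
  change 𝓐.π r * a * 𝓐.π (𝓗.counit (1 * 1)) = 1 * a * 𝓐.π (𝓗.counit (𝓗.tgt r * 1)) at h'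
  have h2 := 𝓗.counit_left r 1
  rw [one_mul, 𝓗.counit_one, mul_one] at h2
  simpa [𝓗.counit_one, h2] using h'

/-- A coordinate map composed with the coaction is right linear over the coinvariants. -/
theorem RightComoduleAlgebra.δ_mul_coinvariant (a b : A) (hb : 𝓐.IsCoinvariant b)
    (c : 𝓗.Tensor 𝓐.π →+ A) (φ : H → R) (hc : ∀ a h, c (𝓗.tmul 𝓐.π a h) = a * 𝓐.π (φ h)) :
    c (𝓐.δ (a * b)) = c (𝓐.δ a) * b := by
  rw [𝓐.δ_mul]
  have hδ : (⟨𝓐.δ b, 𝓐.δ_mem b⟩ : RingTensor.takeuchi 𝓐.π 𝓗.tgt) =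
      ⟨𝓗.tmul 𝓐.π b 1, hb ▸ 𝓐.δ_mem b⟩ := Subtype.ext hb
  rw [hδ]
  have key : c.comp ((RingTensor.takeuchiMul 𝓐.π 𝓗.tgt).flip ⟨𝓗.tmul 𝓐.π b 1, hb ▸ 𝓐.δ_mem b⟩) =
      (AddMonoidHom.mulRight b).comp c :=
    BalTensor.hom_ext fun x h => by
      change c (𝓗.tmul 𝓐.π (x * b) (h * 1)) = c (𝓗.tmul 𝓐.π x h) * b
      rw [hc, hc, mul_one, mul_assoc, mul_assoc, hb.commute_π]
  exact DFunLike.congr_fun key (𝓐.δ a)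

/-- A ring homomorphism with left adjoint `lam` that is Galois for a left finite projective
bialgebroid satisfies `ρ lam ρ ≤ ρ`. -/
theorem RightComoduleAlgebra.IsGalois.isSummandOf {𝓐 : RightComoduleAlgebra 𝓗 A}
    (hG : 𝓐.IsGalois ρ) (hH : 𝓗.IsLeftFiniteProjective) {lam : A →+* B}
    (hlam : IsLeftAdjoint lam ρ) : IsSummandOf ((ρ.comp lam).comp ρ) ρ := by
  obtain ⟨hρ, -, hinj, hsurj⟩ := hG
  obtain ⟨n, x, φ, hφ, hx⟩ := hH.exists_dualBasis
  obtain ⟨e, m, he, hm, h1, h2⟩ := hlam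
  simp only [IsIntertwiner, RingHom.comp_apply, RingHom.id_apply] at he hm
  let c : Fin n → 𝓗.Tensor 𝓐.π →+ A := fun i => 𝓗.coordMap 𝓐.π (φ i) (hφ i)
  have hc : ∀ i a h, c i (𝓗.tmul 𝓐.π a h) = a * 𝓐.π (φ i h) := fun _ _ _ => rfl
  have hsum : ∀ z, ∑ i, 𝓗.tmul 𝓐.π (c i z) (x i) = z := SourceTarget.sum_coordMap 𝓐.π hφ hx
  -- `G` is left `A`-linear and turns the right `B`-action on `A ⊗_B A` into right multiplication by
  -- `ρ lam ρ`.
  let G : RightComoduleAlgebra.SelfTensor ρ →+ A := BalTensor.lift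
    (AddMonoidHom.mk' (fun a => (AddMonoidHom.mulLeft a).comp
        (((ρ : B →+ A).comp (AddMonoidHom.mulLeft e)).comp (lam : A →+ B)))
      (fun a a' => by ext; simp [add_mul]))
    (fun b a a' => by
      change a * ρ b * ρ (e * lam a') = a * ρ (e * lam (ρ b * a'))
      rw [map_mul lam, ← mul_assoc e, he, mul_assoc b, map_mul ρ b, mul_assoc])
  let L : A → RightComoduleAlgebra.SelfTensor ρ →+ RightComoduleAlgebra.SelfTensor ρ := fun a =>
    BalTensor.map (AddMonoidHom.mulLeft a) (AddMonoidHom.id A)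
      (fun b a' => (mul_assoc a a' (ρ b)).symm) (fun _ _ => rfl)
  let Rt : B → RightComoduleAlgebra.SelfTensor ρ →+ RightComoduleAlgebra.SelfTensor ρ := fun b =>
    BalTensor.map (AddMonoidHom.id A) (AddMonoidHom.mulRight (ρ b))
      (fun _ _ => rfl) (fun b' a' => mul_assoc (ρ b') a' (ρ b))
  have hGL : ∀ a z, G (L a z) = a * G z := fun a z => DFunLike.congr_fun
    (show G.comp (L a) = (AddMonoidHom.mulLeft a).comp G from BalTensor.hom_ext fun y y' => by
      change a * y * ρ (e * lam y') = a * (y * ρ (e * lam y'))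
      rw [mul_assoc]) z
  have hGR : ∀ b z, G (Rt b z) = G z * ρ (lam (ρ b)) := fun b z => DFunLike.congr_fun
    (show G.comp (Rt b) = (AddMonoidHom.mulRight (ρ (lam (ρ b)))).comp G from
      BalTensor.hom_ext fun y y' => by
        change y * ρ (e * lam (y' * ρ b)) = y * ρ (e * lam y') * ρ (lam (ρ b))
        simp only [map_mul, mul_assoc]) z
  have hΓL : ∀ a z, 𝓐.galoisMap ρ hρ (L a z) =
      RingTensor.lmul 𝓐.π 𝓗.tgt a 1 (𝓐.galoisMap ρ hρ z) := fun a z => DFunLike.congr_fun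
    (show (𝓐.galoisMap ρ hρ).comp (L a) =
        (RingTensor.lmul 𝓐.π 𝓗.tgt a 1).comp (𝓐.galoisMap ρ hρ) from
      BalTensor.hom_ext fun y y' => by
        change RingTensor.lmul 𝓐.π 𝓗.tgt (a * y) 1 (𝓐.δ y') =
          RingTensor.lmul 𝓐.π 𝓗.tgt a 1 (RingTensor.lmul 𝓐.π 𝓗.tgt y 1 (𝓐.δ y'))
        rw [← RingTensor.lmul_mul, mul_one]) z
  have hcL : ∀ i a z, c i (RingTensor.lmul 𝓐.π 𝓗.tgt a 1 z) = a * c i z := fun i a z =>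
    DFunLike.congr_fun
    (show (c i).comp (RingTensor.lmul 𝓐.π 𝓗.tgt a 1) = (AddMonoidHom.mulLeft a).comp (c i) from
      BalTensor.hom_ext fun y h => by
        change a * y * 𝓐.π (φ i (1 * h)) = a * (y * 𝓐.π (φ i h))
        rw [one_mul, mul_assoc]) z
  have hcR : ∀ i b z, c i (𝓐.galoisMap ρ hρ (Rt b z)) = c i (𝓐.galoisMap ρ hρ z) * ρ b :=
    fun i b z => DFunLike.congr_fun
    (show ((c i).comp (𝓐.galoisMap ρ hρ)).comp (Rt b) =
        (AddMonoidHom.mulRight (ρ b)).comp ((c i).comp (𝓐.galoisMap ρ hρ)) from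
      BalTensor.hom_ext fun y y' => by
        change c i (RingTensor.lmul 𝓐.π 𝓗.tgt y 1 (𝓐.δ (y' * ρ b))) =
          c i (RingTensor.lmul 𝓐.π 𝓗.tgt y 1 (𝓐.δ y')) * ρ b
        rw [hcL, hcL, 𝓐.δ_mul_coinvariant y' (ρ b) (hρ b) (c i) (φ i) (hc i), mul_assoc]) z
  choose z hz using fun i => hsurj (𝓗.tmul 𝓐.π 1 (x i))
  let w : RightComoduleAlgebra.SelfTensor ρ := BalTensor.mk _ _ 1 m
  -- Naturality of `m` produces `ρ lam ρ(b)` in front of `m`, and balancing moves it to the first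
  -- factor.
  have hw : ∀ b, Rt b w = L (ρ (lam (ρ b))) w := by
    intro b
    have h : BalTensor.mk (fun b => AddMonoidHom.mulRight (ρ b))
        (fun b => AddMonoidHom.mulLeft (ρ b)) (1 * ρ (lam (ρ b))) m =
        BalTensor.mk _ _ 1 (ρ (lam (ρ b)) * m) := BalTensor.mk_balanced _ _ _ _ _
    change BalTensor.mk _ _ 1 (m * ρ b) = BalTensor.mk _ _ (ρ (lam (ρ b)) * 1) m
    rw [hm, ← h, one_mul, mul_one]
  refine ⟨n, fun i => c i (𝓐.galoisMap ρ hρ w), fun i => G (z i), fun i b => ?_, fun i b => ?_, ?_⟩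
  · change G (z i) * ρ (lam (ρ b)) = ρ b * G (z i)
    -- It suffices that `z i · b = ρ(b) · z i`. Under the injective Galois map `z i` is `1 ⊗ x i`,
    -- whose coordinates lie in `π(R)` and so commute with `ρ(b)`.
    rw [← hGR, ← hGL]
    congr 1
    apply hinj
    refine SourceTarget.tensor_ext 𝓐.π hφ hx fun j => ?_
    change c j _ = c j _
    rw [hcR, hΓL, hcL, hz, hc, one_mul, (hρ b).commute_π]
  · change c i (𝓐.galoisMap ρ hρ w) * ρ b = ρ (lam (ρ b)) * c i (𝓐.galoisMap ρ hρ w)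
    rw [← hcR, hw, hΓL, hcL]
  -- Dual basis expansion of the Galois image of `w`, pulled back to `A ⊗_B A`. Applying `G` turns
  -- it into the desired sum, and `G w = ρ(e lam(m)) = 1`.
  · have hw' : w = ∑ i, L (c i (𝓐.galoisMap ρ hρ w)) (z i) := by
      apply hinj
      rw [map_sum]
      conv_lhs => rw [← hsum (𝓐.galoisMap ρ hρ w)]
      refine Finset.sum_congr rfl fun i _ => ?_
      rw [hΓL, hz, RingTensor.lmul_tmul, mul_one, one_mul]
    calc ∑ i, c i (𝓐.galoisMap ρ hρ w) * G (z i) = G w := by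
          conv_rhs => rw [hw', map_sum]
          exact Finset.sum_congr rfl fun i _ => (hGL _ _).symm
      _ = 1 := by
          change 1 * ρ (e * lam m) = 1
          rw [h2, map_one, mul_one]

end Galois

/-! ### The bialgebroid of a depth two homomorphism with a left adjoint -/

/-- A left adjoint `lam` of `ρ`, with counit `e` and unit `m`, together with a direct summand diagram
which exhibits `ρ lam ρ ≤ ρ`. -/
structure AdjointDepthTwo {B : Type u} {A : Type v} [Ring B] [Ring A] (ρ : B →+* A) where
  lam : A →+* B
  e : B
  m : A
  n : ℕ
  inj : Fin n → A
  pr : Fin n → A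
  counit_nat : ∀ b, e * lam (ρ b) = b * e
  unit_nat : ∀ a, m * a = ρ (lam a) * m
  counit_unit : ρ e * m = 1
  counit_lam_unit : e * lam m = 1
  pr_nat : ∀ i b, pr i * ρ (lam (ρ b)) = ρ b * pr i
  inj_nat : ∀ i b, inj i * ρ b = ρ (lam (ρ b)) * inj i
  sum_inj_pr : ∑ i, inj i * pr i = 1

namespace AdjointDepthTwo

variable {B : Type u} {A : Type v} [Ring B] [Ring A] {ρ : B →+* A} (D : AdjointDepthTwo ρ)

/-! ### Calculus of the monad `Q` -/

/-- The monad `Q = ρ lam` on `A`. -/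
def Q : A →+* A := ρ.comp D.lam

/-- The multiplication `ρ(e) : Q Q ⟶ Q` of the monad. -/
def E : A := ρ D.e

theorem E_Q_ρ (b : B) : D.E * D.Q (ρ b) = ρ b * D.E := by
  simp only [E, Q, RingHom.comp_apply, ← map_mul, D.counit_nat]

theorem E_Q_Q (a : A) : D.E * D.Q (D.Q a) = D.Q a * D.E := D.E_Q_ρ (D.lam a)

/-- Associativity of the monad: the naturality of `e` applied to `e` itself. -/
theorem E_Q_E : D.E * D.Q D.E = D.E * D.E := D.E_Q_ρ D.e

theorem m_mul (a : A) : D.m * a = D.Q a * D.m := D.unit_nat a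

theorem E_m : D.E * D.m = 1 := D.counit_unit

theorem E_Q_m : D.E * D.Q D.m = 1 := by
  simp only [E, Q, RingHom.comp_apply, ← map_mul, D.counit_lam_unit, map_one]

theorem inj_Q (i : Fin D.n) (a : A) : D.inj i * D.Q a = D.Q (D.Q a) * D.inj i := D.inj_nat i _

/-- The variants with a trailing factor `z` let the relations act inside right-associated products.
-/
theorem E_Q_ρ_mul (b : B) (z : A) : D.E * (D.Q (ρ b) * z) = ρ b * (D.E * z) := by
  rw [← mul_assoc, E_Q_ρ, mul_assoc]

theorem E_Q_Q_mul (a z : A) : D.E * (D.Q (D.Q a) * z) = D.Q a * (D.E * z) := D.E_Q_ρ_mul _ _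

theorem E_Q_E_mul (z : A) : D.E * (D.Q D.E * z) = D.E * (D.E * z) := D.E_Q_ρ_mul _ _

theorem E_m_mul (z : A) : D.E * (D.m * z) = z := by rw [← mul_assoc, E_m, one_mul]

theorem E_Q_m_mul (z : A) : D.E * (D.Q D.m * z) = z := by rw [← mul_assoc, E_Q_m, one_mul]

theorem inj_Q_mul (i : Fin D.n) (a z : A) :
    D.inj i * (D.Q a * z) = D.Q (D.Q a) * (D.inj i * z) := by
  rw [← mul_assoc, inj_Q, mul_assoc]

/-- The base ring `End ρ`. -/
abbrev Base (_ : AdjointDepthTwo ρ) : Type v := endRing ρ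

/-- The ring `End Q` of 2-cells of the monad. -/
abbrev EndQ : Type v := endRing D.Q

variable (r : D.Base)

theorem base_ρ (b : B) : (r : A) * ρ b = ρ b * r := r.2 b

theorem base_Q (a : A) : (r : A) * D.Q a = D.Q a * r := r.2 _

theorem base_E : (r : A) * D.E = D.E * r := r.2 _

theorem base_E_mul (z : A) : (r : A) * (D.E * z) = D.E * (r * z) := by
  rw [← mul_assoc, base_E, mul_assoc]

theorem base_Q_mul (a z : A) : (r : A) * (D.Q a * z) = D.Q a * (r * z) := by
  rw [← mul_assoc, base_Q, mul_assoc]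

/-! ### Mates and the source and target maps -/

/-- A 2-cell of `ρ` is a 2-cell of `Q = ρ lam`. -/
def tgtHom : D.Base →+* D.EndQ where
  toFun r := ⟨r, fun a => D.base_Q r a⟩
  map_one' := rfl
  map_mul' _ _ := rfl
  map_zero' := rfl
  map_add' _ _ := rfl

/-- The mate `σ(r) : Q ⟶ Q` of a 2-cell `r` of `ρ`. -/
def σ (r : A) : A := D.E * D.Q (r * D.m)

/-- Mates lie in `ρ(B)`. Hence they commute with `End ρ` and slide through `E` by naturality. -/
theorem σ_eq_ρ (a : A) : D.σ a = ρ (D.e * D.lam (a * D.m)) := by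
  simp [σ, E, Q]

/-- The characteristic property of the mate at the counit; `σ_m` is its counterpart at the unit.
This makes `evalH` balanced and places `Δ` in the Takeuchi product. -/
theorem E_σ : D.E * D.σ r = D.E * D.Q r := by
  rw [σ, ← E_Q_E_mul, ← map_mul, ← mul_assoc, ← base_E, mul_assoc, E_m, mul_one]

theorem E_σ_mul (z : A) : D.E * (D.σ r * z) = D.E * (D.Q r * z) := by
  rw [← mul_assoc, E_σ, mul_assoc]

theorem E_Q_σ_mul (a z : A) : D.E * (D.Q (D.σ a) * z) = D.σ a * (D.E * z) := by
  rw [σ_eq_ρ, E_Q_ρ_mul]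

theorem σ_Q (a : A) : D.σ r * D.Q a = D.Q a * D.σ r := by
  rw [σ, mul_assoc, ← map_mul, mul_assoc, m_mul, base_Q_mul, map_mul, E_Q_Q_mul]

theorem σ_m : D.σ r * D.m = r * D.m := by
  rw [σ, mul_assoc, ← m_mul, E_m_mul]

theorem base_σ (a : A) : (r : A) * D.σ a = D.σ a * r := by
  rw [σ_eq_ρ, base_ρ]

/-- Passing to mates reverses composition, which is why `H` is the opposite ring of `End Q`. -/
theorem σ_mul (r r' : D.Base) : D.σ (r * r') = D.σ r' * D.σ r := by
  rw [σ, mul_assoc, map_mul, ← E_σ_mul, σ_Q, ← mul_assoc]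
  rfl

/-- The mates of the 2-cells of `ρ` form an anti-homomorphism to `End Q`. -/
def srcHom : D.Base →+* D.EndQᵐᵒᵖ where
  toFun r := MulOpposite.op ⟨D.σ r, fun a => D.σ_Q r a⟩
  map_one' := MulOpposite.unop_injective (Subtype.ext (by
    change D.E * D.Q (1 * D.m) = 1
    rw [one_mul, E_Q_m]))
  map_mul' r r' := MulOpposite.unop_injective (Subtype.ext (D.σ_mul r r'))
  map_zero' := MulOpposite.unop_injective (Subtype.ext (by simp [σ]))
  map_add' r r' := MulOpposite.unop_injective (Subtype.ext (by simp [σ, add_mul, mul_add]))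

/-- The source and target maps of the bialgebroid `(End Q)ᵒᵖ`. -/
def sourceTarget : SourceTarget D.Base D.EndQᵐᵒᵖ where
  s := D.srcHom
  t := D.tgtHom.op
  comm r r' := MulOpposite.unop_injective (Subtype.ext (D.base_σ r'.unop r))

/-- The underlying element of `A`. -/
def val : D.EndQᵐᵒᵖ →+ A :=
  ((endRing D.Q).subtype : D.EndQ →+ A).comp (MulOpposite.opAddEquiv.symm : D.EndQᵐᵒᵖ ≃+ D.EndQ)

theorem val_injective : Function.Injective D.val := fun _ _ h =>
  MulOpposite.unop_injective (Subtype.ext h)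

/-- The element of `(End Q)ᵒᵖ` given by a 2-cell of `Q`. -/
def ofIntertwiner (a : A) (ha : IsIntertwiner D.Q D.Q a) : D.EndQᵐᵒᵖ := MulOpposite.op ⟨a, ha⟩

@[simp]
theorem val_ofIntertwiner (a : A) (ha : IsIntertwiner D.Q D.Q a) :
    D.val (D.ofIntertwiner a ha) = a := rfl

@[simp]
theorem val_one : D.val 1 = 1 := rfl

@[simp]
theorem val_mul (g h : D.EndQᵐᵒᵖ) : D.val (g * h) = D.val h * D.val g := rfl

@[simp]
theorem val_s : D.val (D.sourceTarget.s r) = D.σ r := rfl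

@[simp]
theorem val_tgt : D.val (D.sourceTarget.tgt r) = r := rfl

variable (h : D.EndQᵐᵒᵖ)

theorem val_Q (a : A) : D.val h * D.Q a = D.Q a * D.val h := h.unop.2 a

theorem val_Q_mul (a z : A) : D.val h * (D.Q a * z) = D.Q a * (D.val h * z) := by
  rw [← mul_assoc, val_Q, mul_assoc]

/-! ### The dual basis of `_R H` -/

/-- The dual basis elements of `_R H`. -/
def basis (i : Fin D.n) : D.EndQᵐᵒᵖ :=
  D.ofIntertwiner (D.pr i * D.Q D.m) fun a => by
    have h : D.pr i * D.Q (D.Q a) = D.Q a * D.pr i := D.pr_nat i (D.lam a)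
    rw [mul_assoc, ← map_mul, m_mul, map_mul, ← mul_assoc, h, mul_assoc]

theorem val_basis (i : Fin D.n) : D.val (D.basis i) = D.pr i * D.Q D.m := rfl

/-- Naturality of `pr i` at `e` moves `E` past it, and the triangle identity cancels `m`; so
evaluation recovers the projections. -/
theorem E_basis (i : Fin D.n) : D.E * D.val (D.basis i) = D.pr i := by
  have h : D.pr i * D.Q D.E = D.E * D.pr i := D.pr_nat i D.e
  rw [val_basis, ← mul_assoc, ← h, mul_assoc, ← map_mul, E_m, map_one, mul_one]

/-- The 2-cell `ρ(e) h a` of `ρ`, for `a : ρ ⟶ Q ρ`. -/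
def pairing (a : A) (ha : ∀ b, a * ρ b = D.Q (ρ b) * a) : D.EndQᵐᵒᵖ →+ D.Base :=
  AddMonoidHom.mk' (fun h => ⟨D.E * (D.val h * a), fun b => by
      rw [mul_assoc, mul_assoc, ha, val_Q_mul, E_Q_ρ_mul]⟩)
    (fun g h => Subtype.ext (by simp [add_mul, mul_add]))

theorem coe_pairing (a : A) (ha : ∀ b, a * ρ b = D.Q (ρ b) * a) :
    (D.pairing a ha h : A) = D.E * (D.val h * a) := rfl

theorem pairing_tgt (a : A) (ha : ∀ b, a * ρ b = D.Q (ρ b) * a) (r : D.Base) :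
    D.pairing a ha (h * D.sourceTarget.tgt r) = r * D.pairing a ha h := Subtype.ext (by
  rw [coe_pairing, val_mul, val_tgt, Subring.coe_mul, coe_pairing, base_E_mul, mul_assoc])

/-- The dual basis functionals of `_R H`. -/
def coord (i : Fin D.n) : D.EndQᵐᵒᵖ →+ D.Base := D.pairing (D.inj i) (D.inj_nat i)

theorem coe_coord (i : Fin D.n) : (D.coord i h : A) = D.E * (D.val h * D.inj i) := rfl

theorem coord_tgt (i : Fin D.n) (r : D.Base) (h : D.EndQᵐᵒᵖ) :
    D.coord i (h * D.sourceTarget.tgt r) = r * D.coord i h := D.pairing_tgt h _ _ r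

/-- The sum `∑ inj i * pr i` collapses to `1`, leaving `E h Q(m) = E Q(m) h = h` by the triangle
identity. -/
theorem sum_basis_coord : ∑ i, D.basis i * D.sourceTarget.tgt (D.coord i h) = h := by
  apply D.val_injective
  rw [map_sum]
  calc ∑ i, D.val (D.basis i * D.sourceTarget.tgt (D.coord i h))
      = ∑ i, D.E * (D.val h * (D.inj i * D.pr i * D.Q D.m)) := by
        refine Finset.sum_congr rfl fun i _ => ?_
        rw [val_mul, val_tgt, coe_coord, val_basis]
        simp only [mul_assoc]
    _ = D.val h := by
        rw [← Finset.mul_sum, ← Finset.mul_sum, ← Finset.sum_mul, D.sum_inj_pr, one_mul, val_Q,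
          E_Q_m_mul]

theorem isLeftFiniteProjective : D.sourceTarget.IsLeftFiniteProjective :=
  SourceTarget.isLeftFiniteProjective_of_dualBasis D.coord_tgt D.sum_basis_coord

/-! #### Evaluation of tensors -/

/-- The inclusion `End ρ ⊆ A`. -/
abbrev incl : D.Base →+* A := (endRing ρ).subtype

/-- `A ⊗_R H`. -/
abbrev TensorA : Type v := D.sourceTarget.Tensor D.incl

/-- `H ⊗_R H`. -/
abbrev TensorH : Type v := D.sourceTarget.Tensor D.sourceTarget.s

/-- `A ⊗_R H → A`, `a ⊗ h ↦ a ρ(e) h`. -/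
def evalA : D.TensorA →+ A :=
  BalTensor.lift
    (AddMonoidHom.mk' (fun a => (AddMonoidHom.mulLeft (a * D.E)).comp D.val)
      (fun a a' => by ext; simp [add_mul]))
    (fun r a h => by
      change a * r * D.E * D.val h = a * D.E * (r * D.val h)
      simp only [mul_assoc, base_E_mul])

theorem evalA_tmul (a : A) (h : D.EndQᵐᵒᵖ) :
    D.evalA (D.sourceTarget.tmul D.incl a h) = a * D.E * D.val h := rfl

/-- `H ⊗_R H → A`, `g ⊗ h ↦ ρ(e) g Q(h)`, with values in the 2-cells `Q Q ⟶ Q`. -/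
def evalH : D.TensorH →+ A :=
  BalTensor.lift
    (AddMonoidHom.mk' (fun g => (AddMonoidHom.mulLeft (D.E * D.val g)).comp
        ((D.Q : A →+ A).comp D.val))
      (fun g g' => by ext; simp [add_mul, mul_add]))
    (fun r g h => by
      change D.E * (D.σ r * D.val g) * D.Q (D.val h) = D.E * D.val g * D.Q (r * D.val h)
      rw [mul_assoc, mul_assoc, E_σ_mul, map_mul, mul_assoc, val_Q_mul])

/-- To compare additive maps out of `A ⊗_R H`, compare them on pure tensors. -/
theorem tensorA_congr {T : Type*} [AddCommGroup T] {f g : D.TensorA →+ T}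
    (h : ∀ a x, f (D.sourceTarget.tmul D.incl a x) = g (D.sourceTarget.tmul D.incl a x))
    (z : D.TensorA) : f z = g z :=
  DFunLike.congr_fun (BalTensor.hom_ext h) z

/-- To compare additive maps out of `H ⊗_R H`, compare them on pure tensors. -/
theorem tensorH_congr {T : Type*} [AddCommGroup T] {f g : D.TensorH →+ T}
    (h : ∀ x y, f (D.sourceTarget.tmul D.sourceTarget.s x y) =
      g (D.sourceTarget.tmul D.sourceTarget.s x y))
    (z : D.TensorH) : f z = g z :=
  DFunLike.congr_fun (BalTensor.hom_ext h) z

/-- The coordinate maps `A ⊗_R H → A`. -/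
def coordA (i : Fin D.n) : D.TensorA →+ A :=
  D.sourceTarget.coordMap D.incl (D.coord i) (D.coord_tgt i)

/-- The coordinate maps `H ⊗_R H → H`. -/
def coordH (i : Fin D.n) : D.TensorH →+ D.EndQᵐᵒᵖ :=
  D.sourceTarget.coordMap D.sourceTarget.s (D.coord i) (D.coord_tgt i)

/-- Coordinates factor through the evaluation, and they determine a tensor; this forces `evalA` to
be injective. `val_coordH` plays the same role for `evalH`. -/
theorem coordA_eq (i : Fin D.n) (z : D.TensorA) : D.coordA i z = D.evalA z * D.inj i :=
  D.tensorA_congr (f := D.coordA i) (g := (AddMonoidHom.mulRight (D.inj i)).comp D.evalA)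
    (fun a h => by
      change a * (D.E * (D.val h * D.inj i)) = a * D.E * D.val h * D.inj i
      simp only [mul_assoc]) z

theorem val_coordH (i : Fin D.n) (z : D.TensorH) :
    D.val (D.coordH i z) = D.E * (D.evalH z * D.Q (D.inj i * D.m)) :=
  D.tensorH_congr (f := D.val.comp (D.coordH i))
    (g := (AddMonoidHom.mulLeft D.E).comp
      ((AddMonoidHom.mulRight (D.Q (D.inj i * D.m))).comp D.evalH))
    (fun g h => by
      change D.E * D.Q (D.E * (D.val h * D.inj i) * D.m) * D.val g =
        D.E * (D.E * D.val g * D.Q (D.val h) * D.Q (D.inj i * D.m))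
      simp only [mul_assoc, map_mul, val_Q_mul, E_Q_E_mul, val_Q]) z

theorem evalA_injective : Function.Injective D.evalA := fun z z' h =>
  SourceTarget.tensor_ext D.incl D.coord_tgt D.sum_basis_coord fun i => by
    change D.coordA i z = D.coordA i z'
    rw [coordA_eq, coordA_eq, h]

theorem evalH_injective : Function.Injective D.evalH := fun z z' h =>
  SourceTarget.tensor_ext D.sourceTarget.s D.coord_tgt D.sum_basis_coord fun i =>
    D.val_injective (by
      change D.val (D.coordH i z) = D.val (D.coordH i z')
      rw [val_coordH, val_coordH, h])

theorem evalA_surjective : Function.Surjective D.evalA := fun a =>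
  -- Since `E` times `basis i` is `pr i`, this tensor evaluates to `a ∑ inj i * pr i`.
  ⟨∑ i, D.sourceTarget.tmul D.incl (a * D.inj i) (D.basis i), by
    rw [map_sum]
    calc ∑ i, D.evalA (D.sourceTarget.tmul D.incl (a * D.inj i) (D.basis i))
        = ∑ i, a * (D.inj i * D.pr i) := Finset.sum_congr rfl fun i _ => by
          rw [evalA_tmul, mul_assoc, E_basis, mul_assoc]
      _ = a := by rw [← Finset.mul_sum, D.sum_inj_pr, mul_one]⟩

theorem evalH_Q_Q (z : D.TensorH) (a : A) : D.evalH z * D.Q (D.Q a) = D.Q a * D.evalH z :=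
  D.tensorH_congr (f := (AddMonoidHom.mulRight (D.Q (D.Q a))).comp D.evalH)
    (g := (AddMonoidHom.mulLeft (D.Q a)).comp D.evalH)
    (fun g h => by
      change D.E * D.val g * D.Q (D.val h) * D.Q (D.Q a) =
        D.Q a * (D.E * D.val g * D.Q (D.val h))
      rw [mul_assoc, ← map_mul, val_Q, map_mul, mul_assoc, val_Q_mul, E_Q_Q_mul, mul_assoc]) z

theorem evalH_lact (r : D.Base) (z : D.TensorH) :
    D.evalH (D.sourceTarget.lact r z) = r * D.evalH z :=
  D.tensorH_congr (f := D.evalH.comp (D.sourceTarget.lact r))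
    (g := (AddMonoidHom.mulLeft (r : A)).comp D.evalH)
    (fun g h => by
      change D.E * (r * D.val g) * D.Q (D.val h) = r * (D.E * D.val g * D.Q (D.val h))
      simp only [mul_assoc, base_E_mul]) z

theorem evalH_ract (r : D.Base) (z : D.TensorH) :
    D.evalH (D.sourceTarget.ract D.sourceTarget.s r z) = D.σ r * D.evalH z :=
  D.tensorH_congr (f := D.evalH.comp (D.sourceTarget.ract D.sourceTarget.s r))
    (g := (AddMonoidHom.mulLeft (D.σ r)).comp D.evalH)
    (fun g h => by
      change D.E * D.val g * D.Q (D.σ r * D.val h) = D.σ r * (D.E * D.val g * D.Q (D.val h))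
      simp only [mul_assoc, map_mul, val_Q_mul, E_Q_σ_mul]) z

theorem evalA_ract (r : D.Base) (z : D.TensorA) :
    D.evalA (D.sourceTarget.ract D.incl r z) = D.evalA z * D.Q r :=
  D.tensorA_congr (f := D.evalA.comp (D.sourceTarget.ract D.incl r))
    (g := (AddMonoidHom.mulRight (D.Q r)).comp D.evalA)
    (fun a h => by
      change a * D.E * (D.σ r * D.val h) = a * D.E * D.val h * D.Q r
      simp only [mul_assoc, E_σ_mul, val_Q]) z

theorem evalH_lmul (g h : D.EndQᵐᵒᵖ) (z : D.TensorH) :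
    D.evalH (RingTensor.lmul D.sourceTarget.s D.sourceTarget.tgt g h z) =
      D.evalH z * (D.val g * D.Q (D.val h)) :=
  D.tensorH_congr (f := D.evalH.comp (RingTensor.lmul D.sourceTarget.s D.sourceTarget.tgt g h))
    (g := (AddMonoidHom.mulRight (D.val g * D.Q (D.val h))).comp D.evalH)
    (fun g' h' => by
      change D.E * (D.val g' * D.val g) * D.Q (D.val h' * D.val h) =
        D.E * D.val g' * D.Q (D.val h') * (D.val g * D.Q (D.val h))
      simp only [mul_assoc, map_mul, val_Q_mul, val_Q]) z

theorem evalA_lmul (a : A) (h : D.EndQᵐᵒᵖ) (z : D.TensorA) :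
    D.evalA (RingTensor.lmul D.incl D.sourceTarget.tgt a h z) = a * D.evalA z * D.val h :=
  D.tensorA_congr (f := D.evalA.comp (RingTensor.lmul D.incl D.sourceTarget.tgt a h))
    (g := (AddMonoidHom.mulRight (D.val h)).comp ((AddMonoidHom.mulLeft a).comp D.evalA))
    (fun a' h' => by
      change a * a' * D.E * (D.val h' * D.val h) = a * (a' * D.E * D.val h') * D.val h
      simp only [mul_assoc]) z

/-! #### Comultiplication and counit -/

/-- The components of the comultiplication. -/
def comulCoord (i : Fin D.n) : D.EndQᵐᵒᵖ →+ D.EndQᵐᵒᵖ :=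
  -- The coordinate that `val_coordH` prescribes for a tensor with evaluation `h E`.
  AddMonoidHom.mk' (fun h => D.ofIntertwiner
      (D.E * (D.val h * (D.E * D.Q (D.inj i * D.m)))) fun a => by
        simp only [mul_assoc, ← map_mul, m_mul, inj_Q_mul]
        rw [map_mul, E_Q_Q_mul, val_Q_mul, E_Q_Q_mul])
    (fun g h => D.val_injective (by simp [add_mul, mul_add]))

/-- The comultiplication `Δ : H → H ⊗_R H`, with `ρ(e) h₍₁₎ Q(h₍₂₎) = h ρ(e)`. -/
def comul : D.EndQᵐᵒᵖ →+ D.TensorH :=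
  ∑ i, ((BalTensor.mk _ _).flip (D.basis i)).comp (D.comulCoord i)

/-- As `evalH` is injective, this characterizes `Δ`; all its axioms are deduced from this formula.
-/
theorem evalH_comul (h : D.EndQᵐᵒᵖ) : D.evalH (D.comul h) = D.val h * D.E := by
  have hi : ∀ i, D.evalH (D.sourceTarget.tmul D.sourceTarget.s (D.comulCoord i h) (D.basis i)) =
      D.E * (D.val h * (D.E * D.Q (D.inj i * D.pr i * D.Q D.m))) := by
    intro i
    have hE : D.inj i * D.E = D.Q D.E * D.inj i := D.inj_nat i D.e
    -- Inserting `1 = E m` between `inj i` and `pr i` creates the factor `inj i * m` occurring in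
    -- `comulCoord`.
    have hm : D.inj i * D.pr i * D.Q D.m =
        D.Q D.E * (D.inj i * D.m * (D.pr i * D.Q D.m)) := by
      rw [← mul_assoc (D.Q D.E), ← mul_assoc (D.Q D.E), ← hE, mul_assoc (D.inj i) D.E, E_m,
        mul_one, mul_assoc]
    rw [hm, map_mul, E_Q_Q_mul, val_Q_mul, E_Q_E_mul, map_mul]
    change D.E * (D.E * (D.val h * (D.E * D.Q (D.inj i * D.m)))) * D.Q (D.pr i * D.Q D.m) = _
    simp only [mul_assoc]
  rw [comul, AddMonoidHom.finsetSum_apply, map_sum]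
  calc _ = ∑ i, D.E * (D.val h * (D.E * D.Q (D.inj i * D.pr i * D.Q D.m))) :=
        Finset.sum_congr rfl fun i _ => hi i
    _ = D.val h * D.E := by
        rw [← Finset.mul_sum, ← Finset.mul_sum, ← Finset.mul_sum, ← map_sum, ← Finset.sum_mul,
          D.sum_inj_pr, one_mul, E_Q_Q, val_Q_mul, E_Q_m_mul]

/-- The coring structure of `(End Q)ᵒᵖ`; the counit is `h ↦ ρ(e) h m`. -/
def coringData : RightCoringData D.Base D.EndQᵐᵒᵖ where
  toSourceTarget := D.sourceTarget
  comul := D.comul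
  counit := D.pairing D.m fun b => D.m_mul (ρ b)
  comul_left r h := D.evalH_injective (by
    rw [evalH_lact, evalH_comul, evalH_comul, val_mul, val_tgt, mul_assoc])
  comul_right r h := D.evalH_injective (by
    rw [evalH_ract, evalH_comul, evalH_comul, val_mul, val_s, mul_assoc])
  counit_left r h := D.pairing_tgt h _ _ r
  counit_right r h := Subtype.ext (by
    rw [Subring.coe_mul, coe_pairing, coe_pairing, val_mul, val_s, mul_assoc, E_σ_mul, mul_assoc,
      mul_assoc, m_mul, val_Q_mul])

theorem coe_counit (h : D.EndQᵐᵒᵖ) : (D.coringData.counit h : A) = D.E * (D.val h * D.m) := rfl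

/-- Composed with the unit, `h` acts as its counit; both multiplicativity laws for `ε` rest on this.
-/
theorem counit_mul_m (h : D.EndQᵐᵒᵖ) : (D.coringData.counit h : A) * D.m = D.val h * D.m := by
  rw [coe_counit, mul_assoc, mul_assoc, m_mul, val_Q_mul, E_Q_m_mul]

theorem val_counitId (z : D.TensorH) : D.val (D.coringData.counitId z) = D.evalH z * D.m :=
  D.tensorH_congr (f := D.val.comp D.coringData.counitId)
    (g := (AddMonoidHom.mulRight D.m).comp D.evalH)
    (fun g h => by
      change D.E * (D.val g * D.m) * D.val h = D.E * D.val g * D.Q (D.val h) * D.m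
      simp only [mul_assoc, m_mul]) z

theorem val_idCounit (z : D.TensorH) :
    D.val (D.coringData.idCounit D.sourceTarget.s z) = D.evalH z * D.Q D.m :=
  D.tensorH_congr (f := D.val.comp (D.coringData.idCounit D.sourceTarget.s))
    (g := (AddMonoidHom.mulRight (D.Q D.m)).comp D.evalH)
    (fun g h => by
      change D.E * D.Q (D.coringData.counit h * D.m) * D.val g =
        D.E * D.val g * D.Q (D.val h) * D.Q D.m
      rw [counit_mul_m]
      simp only [mul_assoc, map_mul, val_Q]) z

theorem idCounit_incl (z : D.TensorA) : D.coringData.idCounit D.incl z = D.evalA z * D.m :=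
  D.tensorA_congr (f := D.coringData.idCounit D.incl)
    (g := (AddMonoidHom.mulRight D.m).comp D.evalA)
    (fun a h => by
      change a * (D.E * (D.val h * D.m)) = a * D.E * D.val h * D.m
      simp only [mul_assoc]) z

/-- For `w = Δ(h)` the element `a` is `h`, so the factorwise product `Δ(g) Δ(h)` evaluates to `h g
E`, as `Δ(g h)` does in the opposite ring. -/
theorem evalH_takeuchiMul (z : D.TensorH)
    (w : RingTensor.takeuchi D.sourceTarget.s D.sourceTarget.tgt) (a : A)
    (hw : D.evalH w = a * D.E) :
    D.evalH (RingTensor.takeuchiMul D.sourceTarget.s D.sourceTarget.tgt z w) = a * D.evalH z :=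
  D.tensorH_congr
    (f := D.evalH.comp ((RingTensor.takeuchiMul D.sourceTarget.s D.sourceTarget.tgt).flip w))
    (g := (AddMonoidHom.mulLeft a).comp D.evalH)
    (fun g h => by
      change D.evalH (RingTensor.lmul D.sourceTarget.s D.sourceTarget.tgt g h w) =
        a * (D.E * D.val g * D.Q (D.val h))
      rw [evalH_lmul, hw]
      simp only [mul_assoc]) z

/-- `H ⊗_R (H ⊗_R H) → A`, `g ⊗ w ↦ ρ(e) g Q(w)`, with values in the 2-cells `Q Q Q ⟶ Q`. -/
def evalH₃ : D.sourceTarget.Tensor₃ D.sourceTarget.s →+ A :=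
  BalTensor.lift
    (AddMonoidHom.mk' (fun g => (AddMonoidHom.mulLeft (D.E * D.val g)).comp
        ((D.Q : A →+ A).comp D.evalH))
      (fun g g' => by ext; simp [add_mul, mul_add]))
    (fun r g w => by
      change D.E * (D.σ r * D.val g) * D.Q (D.evalH w) =
        D.E * D.val g * D.Q (D.evalH (D.sourceTarget.lact r w))
      rw [evalH_lact, mul_assoc, mul_assoc, E_σ_mul, map_mul, mul_assoc, val_Q_mul])

/-- `A ⊗_R (H ⊗_R H) → A`, `a ⊗ w ↦ a ρ(e) w`. -/
def evalA₃ : D.sourceTarget.Tensor₃ D.incl →+ A :=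
  BalTensor.lift
    (AddMonoidHom.mk' (fun a => (AddMonoidHom.mulLeft (a * D.E)).comp D.evalH)
      (fun g g' => by ext; simp [add_mul]))
    (fun r a w => by
      change a * r * D.E * D.evalH w = a * D.E * D.evalH (D.sourceTarget.lact r w)
      rw [evalH_lact]
      simp only [mul_assoc, base_E_mul])

/-- A coordinate of the last factor can be read off after evaluating the triple tensor, which
reduces the claim to injectivity of `evalH`. -/
theorem evalH₃_injective : Function.Injective D.evalH₃ := fun z z' hz =>
  SourceTarget.tensor₃_ext D.sourceTarget.s D.coord_tgt D.sum_basis_coord fun i =>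
    D.evalH_injective (by
      have key : D.evalH.comp (D.sourceTarget.coordMap₃ D.sourceTarget.s (D.coord i)
          (D.coord_tgt i)) = (AddMonoidHom.mulRight (D.Q (D.Q (D.inj i * D.m)))).comp
            ((AddMonoidHom.mulLeft D.E).comp D.evalH₃) :=
        BalTensor.hom_ext fun g w => by
          change D.E * D.val g * D.Q (D.val (D.coordH i w)) =
            D.E * (D.E * D.val g * D.Q (D.evalH w)) * D.Q (D.Q (D.inj i * D.m))
          rw [val_coordH]
          simp only [map_mul _ D.E, map_mul _ (D.evalH w), mul_assoc, val_Q_mul, E_Q_E_mul]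
      have h1 := DFunLike.congr_fun key z
      have h2 := DFunLike.congr_fun key z'
      simp only [AddMonoidHom.comp_apply] at h1 h2
      rw [h1, h2, hz])

theorem evalA₃_injective : Function.Injective D.evalA₃ := fun z z' hz =>
  SourceTarget.tensor₃_ext D.incl D.coord_tgt D.sum_basis_coord fun i =>
    D.evalA_injective (by
      have key : D.evalA.comp (D.sourceTarget.coordMap₃ D.incl (D.coord i) (D.coord_tgt i)) =
          (AddMonoidHom.mulRight (D.Q (D.Q D.E) * D.Q (D.inj i * D.m))).comp D.evalA₃ :=
        BalTensor.hom_ext fun a w => by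
          change a * D.E * D.val (D.coordH i w) =
            a * D.E * D.evalH w * (D.Q (D.Q D.E) * D.Q (D.inj i * D.m))
          rw [val_coordH, mul_assoc (a * D.E), ← mul_assoc (D.evalH w), evalH_Q_Q, mul_assoc a,
            mul_assoc a, mul_assoc (D.Q D.E), E_Q_E_mul]
      have h1 := DFunLike.congr_fun key z
      have h2 := DFunLike.congr_fun key z'
      simp only [AddMonoidHom.comp_apply] at h1 h2
      rw [h1, h2, hz])

theorem evalH₃_idComul (z : D.TensorH) :
    D.evalH₃ (D.coringData.idComul D.sourceTarget.s z) = D.evalH z * D.Q D.E :=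
  D.tensorH_congr (f := D.evalH₃.comp (D.coringData.idComul D.sourceTarget.s))
    (g := (AddMonoidHom.mulRight (D.Q D.E)).comp D.evalH)
    (fun g h => by
      change D.E * D.val g * D.Q (D.evalH (D.comul h)) = D.E * D.val g * D.Q (D.val h) * D.Q D.E
      rw [evalH_comul, map_mul]
      simp only [mul_assoc]) z

theorem evalA₃_idComul (z : D.TensorA) :
    D.evalA₃ (D.coringData.idComul D.incl z) = D.evalA z * D.E :=
  D.tensorA_congr (f := D.evalA₃.comp (D.coringData.idComul D.incl))
    (g := (AddMonoidHom.mulRight D.E).comp D.evalA)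
    (fun a h => by
      change a * D.E * D.evalH (D.comul h) = a * D.E * D.val h * D.E
      rw [evalH_comul]
      simp only [mul_assoc]) z

/-- The associativity map `(P ⊗_R H) ⊗_R H → P ⊗_R (H ⊗_R H)`. -/
abbrev assocMap {P : Type*} [Ring P] (p : D.Base →+* P) (z : D.sourceTarget.Tensor p)
    (h : D.EndQᵐᵒᵖ) : D.sourceTarget.Tensor₃ p :=
  BalTensor.assocAux (fun r => AddMonoidHom.mulRight (p r))
    (fun r => AddMonoidHom.mulRight (D.sourceTarget.tgt r))
    (fun r => AddMonoidHom.mulRight (D.sourceTarget.s r))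
    (fun r => AddMonoidHom.mulRight (D.sourceTarget.tgt r)) D.sourceTarget.act_comm z h

theorem evalH₃_assocMap (z : D.TensorH) (h : D.EndQᵐᵒᵖ) :
    D.evalH₃ (D.assocMap D.sourceTarget.s z h) = D.E * (D.evalH z * D.Q (D.Q (D.val h))) :=
  D.tensorH_congr
    (f := D.evalH₃.comp ((BalTensor.assocAux (fun r => AddMonoidHom.mulRight (D.sourceTarget.s r))
      (fun r => AddMonoidHom.mulRight (D.sourceTarget.tgt r))
      (fun r => AddMonoidHom.mulRight (D.sourceTarget.s r))
      (fun r => AddMonoidHom.mulRight (D.sourceTarget.tgt r)) D.sourceTarget.act_comm).flip h))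
    (g := (AddMonoidHom.mulLeft D.E).comp
      ((AddMonoidHom.mulRight (D.Q (D.Q (D.val h)))).comp D.evalH))
    (fun x y => by
      change D.E * D.val x * D.Q (D.E * D.val y * D.Q (D.val h)) =
        D.E * (D.E * D.val x * D.Q (D.val y) * D.Q (D.Q (D.val h)))
      simp only [map_mul, mul_assoc, val_Q_mul, E_Q_E_mul]) z

theorem evalA₃_assocMap (z : D.TensorA) (h : D.EndQᵐᵒᵖ) :
    D.evalA₃ (D.assocMap D.incl z h) = D.evalA z * D.Q (D.E * D.val h) :=
  D.tensorA_congr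
    (f := D.evalA₃.comp ((BalTensor.assocAux (fun r => AddMonoidHom.mulRight (D.incl r))
      (fun r => AddMonoidHom.mulRight (D.sourceTarget.tgt r))
      (fun r => AddMonoidHom.mulRight (D.sourceTarget.s r))
      (fun r => AddMonoidHom.mulRight (D.sourceTarget.tgt r)) D.sourceTarget.act_comm).flip h))
    (g := (AddMonoidHom.mulRight (D.Q (D.E * D.val h))).comp D.evalA)
    (fun a x => by
      change a * D.E * (D.E * D.val x * D.Q (D.val h)) =
        a * D.E * D.val x * D.Q (D.E * D.val h)
      simp only [map_mul, mul_assoc, val_Q_mul, E_Q_E_mul]) z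

theorem evalH₃_coactId (z : D.TensorH) :
    D.evalH₃ (D.coringData.coactId D.sourceTarget.s D.comul D.coringData.comul_right z) =
      D.evalH z * D.E :=
  D.tensorH_congr
    (f := D.evalH₃.comp
      (D.coringData.coactId D.sourceTarget.s D.comul D.coringData.comul_right))
    (g := (AddMonoidHom.mulRight D.E).comp D.evalH)
    (fun g h => by
      change D.evalH₃ (D.assocMap D.sourceTarget.s (D.comul g) h) =
        D.E * D.val g * D.Q (D.val h) * D.E
      rw [evalH₃_assocMap, evalH_comul, mul_assoc (D.val g), E_Q_Q]
      simp only [mul_assoc]) z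

/-- The right bialgebroid `(End Q)ᵒᵖ` over `End ρ`. -/
def bialgebroid : RightBialgebroid D.Base D.EndQᵐᵒᵖ where
  toRightCoringData := D.coringData
  -- Coassociativity evaluates to `h E E = h E Q(E)`, the associativity of the monad; the counit
  -- laws below are its unit laws.
  coassoc h := D.evalH₃_injective (by
    refine (D.evalH₃_coactId (D.comul h)).trans (Eq.trans ?_ (D.evalH₃_idComul (D.comul h)).symm)
    rw [evalH_comul, mul_assoc, mul_assoc, E_Q_E])
  counit_id_comul h := D.val_injective (by
    refine (D.val_counitId (D.comul h)).trans ?_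
    rw [evalH_comul, mul_assoc, E_m, mul_one])
  id_counit_comul h := D.val_injective (by
    refine (D.val_idCounit (D.comul h)).trans ?_
    rw [evalH_comul, mul_assoc, E_Q_m, mul_one])
  comul_mem h r := D.evalH_injective (by
    refine (D.evalH_lmul _ _ (D.comul h)).trans (Eq.trans ?_ (D.evalH_lmul _ _ (D.comul h)).symm)
    change _ * (D.σ r * D.Q 1) = _ * (1 * D.Q r)
    rw [evalH_comul, map_one, mul_one, one_mul, mul_assoc, mul_assoc, E_σ])
  comul_one := D.evalH_injective (by
    refine (D.evalH_comul 1).trans ?_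
    change 1 * D.E = D.E * 1 * D.Q 1
    rw [map_one, one_mul, mul_one, mul_one])
  comul_mul g h := D.evalH_injective (by
    refine (D.evalH_comul (g * h)).trans (Eq.trans ?_
      (D.evalH_takeuchiMul (D.comul g) _ (D.val h) (D.evalH_comul h)).symm)
    rw [evalH_comul, val_mul, mul_assoc])
  counit_one := Subtype.ext (by
    rw [coe_counit, val_one, one_mul, E_m]
    rfl)
  counit_mul_s g h := Subtype.ext (by
    rw [coe_counit, coe_counit, val_mul, val_mul]
    change _ = D.E * (D.val h * D.σ (D.coringData.counit g) * D.m)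
    rw [mul_assoc (D.val h) (D.σ _), σ_m, counit_mul_m, mul_assoc])
  counit_mul_t g h := Subtype.ext (by
    rw [coe_counit, coe_counit, val_mul, val_mul]
    change _ = D.E * (D.val h * (D.coringData.counit g : A) * D.m)
    rw [mul_assoc (D.val h) (D.coringData.counit g : A), counit_mul_m, mul_assoc])

/-! #### The coaction -/

/-- The coaction `δ : A → A ⊗_R H`, with `a₍₀₎ ρ(e) a₍₁₎ = ρ(e) Q(a)`. -/
def coaction : A →+ D.TensorA :=
  -- The coefficients `E Q(a) inj i` are those that `coordA_eq` prescribes for the evaluation `E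
  -- Q(a)`.
  ∑ i, ((BalTensor.mk _ _).flip (D.basis i)).comp
    ((AddMonoidHom.mulRight (D.inj i)).comp ((AddMonoidHom.mulLeft D.E).comp (D.Q : A →+ A)))

theorem evalA_coaction (a : A) : D.evalA (D.coaction a) = D.E * D.Q a := by
  rw [coaction, AddMonoidHom.finsetSum_apply, map_sum]
  calc _ = ∑ i, D.E * D.Q a * (D.inj i * D.pr i) := Finset.sum_congr rfl fun i _ => by
        change D.E * D.Q a * D.inj i * D.E * D.val (D.basis i) = _
        rw [mul_assoc _ D.E, E_basis, mul_assoc _ (D.inj i)]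
    _ = D.E * D.Q a := by rw [← Finset.mul_sum, D.sum_inj_pr, mul_one]

theorem coaction_right (r : D.Base) (a : A) :
    D.coaction (a * D.incl r) = D.sourceTarget.ract D.incl r (D.coaction a) :=
  D.evalA_injective (by
    rw [evalA_ract, evalA_coaction, evalA_coaction, map_mul, ← mul_assoc]
    rfl)

theorem evalA₃_coactId (z : D.TensorA) :
    D.evalA₃ (D.coringData.coactId D.incl D.coaction D.coaction_right z) = D.E * D.Q (D.evalA z) :=
  D.tensorA_congr
    (f := D.evalA₃.comp (D.coringData.coactId D.incl D.coaction D.coaction_right))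
    (g := (AddMonoidHom.mulLeft D.E).comp ((D.Q : A →+ A).comp D.evalA))
    (fun a h => by
      change D.evalA₃ (D.assocMap D.incl (D.coaction a) h) = D.E * D.Q (a * D.E * D.val h)
      rw [evalA₃_assocMap, evalA_coaction, mul_assoc, ← map_mul, mul_assoc]) z

theorem evalA_takeuchiMul (z : D.TensorA)
    (w : RingTensor.takeuchi D.incl D.sourceTarget.tgt) (a : A) (hw : D.evalA w = D.E * D.Q a) :
    D.evalA (RingTensor.takeuchiMul D.incl D.sourceTarget.tgt z w) = D.evalA z * D.Q a :=
  D.tensorA_congr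
    (f := D.evalA.comp ((RingTensor.takeuchiMul D.incl D.sourceTarget.tgt).flip w))
    (g := (AddMonoidHom.mulRight (D.Q a)).comp D.evalA)
    (fun x h => by
      change D.evalA (RingTensor.lmul D.incl D.sourceTarget.tgt x h w) =
        x * D.E * D.val h * D.Q a
      rw [evalA_lmul, hw]
      simp only [mul_assoc, val_Q]) z

/-- The comodule algebra structure of `A` over `(End Q)ᵒᵖ`. -/
def comoduleAlgebra : RightComoduleAlgebra D.bialgebroid A where
  π := D.incl
  δ := D.coaction
  δ_right := D.coaction_right
  -- Both sides evaluate to `E Q(a) E`, by associativity of the monad and naturality of `E`.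
  coassoc a := D.evalA₃_injective (by
    refine (D.evalA₃_coactId (D.coaction a)).trans
      (Eq.trans ?_ (D.evalA₃_idComul (D.coaction a)).symm)
    rw [evalA_coaction, map_mul, E_Q_E_mul, E_Q_Q, mul_assoc])
  counit a := by
    refine (D.idCounit_incl (D.coaction a)).trans ?_
    rw [evalA_coaction, mul_assoc, ← m_mul, E_m_mul]
  δ_mem a r := D.evalA_injective (by
    refine (D.evalA_lmul _ _ (D.coaction a)).trans (Eq.trans ?_ (D.evalA_lmul _ _ (D.coaction a)).symm)
    change (r : A) * _ * 1 = 1 * _ * (r : A)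
    rw [evalA_coaction, mul_one, one_mul, base_E_mul, base_Q, mul_assoc])
  δ_one := D.evalA_injective (by
    refine (D.evalA_coaction 1).trans ?_
    change _ = 1 * D.E * 1
    rw [map_one, one_mul])
  δ_mul a a' := D.evalA_injective (by
    refine (D.evalA_coaction (a * a')).trans (Eq.trans ?_
      (D.evalA_takeuchiMul (D.coaction a) _ a' (D.evalA_coaction a')).symm)
    rw [evalA_coaction, map_mul, mul_assoc])

theorem isCoinvariant_iff (a : A) :
    D.comoduleAlgebra.IsCoinvariant a ↔ D.E * D.Q a = a * D.E := by
  have h : D.evalA (D.sourceTarget.tmul D.incl a 1) = a * D.E := mul_one _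
  rw [← D.evalA_coaction, ← h]
  exact D.evalA_injective.eq_iff.symm

theorem isGalois : D.comoduleAlgebra.IsGalois ρ := by
  have hρ : ∀ b, D.comoduleAlgebra.IsCoinvariant (ρ b) := fun b =>
    (D.isCoinvariant_iff _).2 (D.E_Q_ρ b)
  refine ⟨hρ, fun a ha => ?_, ?_⟩
  · rw [isCoinvariant_iff] at ha
    refine ⟨D.e * D.lam (a * D.m), ?_⟩
    -- A coinvariant satisfies `a = a E Q(m) = E Q(a m)`, which lies in `ρ(B)`.
    rw [← σ_eq_ρ, σ, map_mul, ← mul_assoc, ha, mul_assoc, E_Q_m, mul_one]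
  · have hev : Function.Bijective D.evalA := ⟨D.evalA_injective, D.evalA_surjective⟩
    have hmk : ∀ a a', D.evalA (D.comoduleAlgebra.galoisMap ρ hρ (BalTensor.mk _ _ a a')) =
        a * (D.E * D.Q a') := fun a a' => by
      change D.evalA (RingTensor.lmul D.incl D.sourceTarget.tgt a 1 (D.coaction a')) = _
      rw [evalA_lmul, evalA_coaction, val_one, mul_one]
    -- After the bijection `evalA` the Galois map is `a ⊗ a' ↦ a ρ(e lam(a'))`, and the adjunction
    -- supplies the inverse `a ↦ a ⊗ m`.
    refine (Function.Bijective.of_comp_iff' hev _).1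
      (Function.bijective_iff_has_inverse.2 ⟨fun a => BalTensor.mk _ _ a D.m, fun z => ?_,
        fun a => ?_⟩)
    · refine DFunLike.congr_fun (show ((BalTensor.mk _ _).flip D.m).comp
        (D.evalA.comp (D.comoduleAlgebra.galoisMap ρ hρ)) = AddMonoidHom.id _ from
        BalTensor.hom_ext fun a a' => ?_) z
      change BalTensor.mk _ _ (D.evalA (D.comoduleAlgebra.galoisMap ρ hρ
        (BalTensor.mk _ _ a a'))) D.m = BalTensor.mk _ _ a a'
      have hb : D.E * D.Q a' = ρ (D.e * D.lam a') := (map_mul ρ _ _).symm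
      rw [hmk, hb]
      refine (BalTensor.mk_balanced (fun b => AddMonoidHom.mulRight (ρ b))
        (fun b => AddMonoidHom.mulLeft (ρ b)) _ a D.m).trans ?_
      change BalTensor.mk _ _ a (ρ (D.e * D.lam a') * D.m) = _
      rw [← hb, mul_assoc, ← m_mul, E_m_mul]
    · change D.evalA (D.comoduleAlgebra.galoisMap ρ hρ (BalTensor.mk _ _ a D.m)) = a
      rw [hmk, E_Q_m, mul_one]

end AdjointDepthTwo

/-! ### The equivalence of the four conditions -/

theorem mainTheorem5 {B : Type u} {A : Type v} [Ring B] [Ring A] (ρ : B →+* A) :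
    List.TFAE [
      (∃ (H : Type v) (_ : Ring H) (𝓗 : RightBialgebroid (endRing ρ) H)
          (𝓐 : RightComoduleAlgebra 𝓗 A),
          𝓗.IsLeftFiniteProjective ∧ 𝓐.IsGalois ρ) ∧
        IsLeftRegularHom ρ,
      (∃ (H : Type v) (_ : Ring H) (𝓗 : RightBialgebroid (endRing ρ) H)
          (𝓐 : RightComoduleAlgebra 𝓗 A),
          𝓐.π = (endRing ρ).subtype ∧ 𝓗.IsLeftFiniteProjective ∧ 𝓐.IsGalois ρ) ∧
        IsLeftRegularHom ρ,
      ∃ lam : A →+* B, IsLeftAdjoint lam ρ ∧ IsSummandOf ((ρ.comp lam).comp ρ) ρ,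
      (∃ lam : A →+* B, IsLeftAdjoint lam ρ) ∧
        ∀ lam : A →+* B, IsLeftAdjoint lam ρ → IsSummandOf ((ρ.comp lam).comp ρ) ρ] := by
  tfae_have 2 → 1 := by
    rintro ⟨⟨H, _, 𝓗, 𝓐, -, hH, hG⟩, hreg⟩
    exact ⟨⟨H, _, 𝓗, 𝓐, hH, hG⟩, hreg⟩
  tfae_have 1 → 3 := by
    rintro ⟨⟨H, _, 𝓗, 𝓐, hH, hG⟩, hreg⟩
    obtain ⟨lam, hlam⟩ := hreg.exists_isLeftAdjoint
    exact ⟨lam, hlam, hG.isSummandOf hH hlam⟩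
  tfae_have 3 → 4 := by
    rintro ⟨lam, hlam, hs⟩
    exact ⟨⟨lam, hlam⟩, fun lam' hlam' => hs.of_isLeftAdjoint hlam hlam'⟩
  tfae_have 4 → 2 := by
    rintro ⟨⟨lam, hlam⟩, hs⟩
    obtain ⟨n, a, b, hb, ha, hab⟩ := hs lam hlam
    have hreg := hlam.isLeftRegularHom
    obtain ⟨e, m, he, hm, h1, h2⟩ := hlam
    -- In the diagram for `ρ lam ρ ≤ ρ` the `b i` go from `ρ lam ρ` to `ρ`, so they are the
    -- projections `pr`, and the `a i` are the injections `inj`.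
    let D : AdjointDepthTwo ρ := ⟨lam, e, m, n, a, b, he, hm, h1, h2, hb, ha, hab⟩
    exact ⟨⟨_, _, D.bialgebroid, D.comoduleAlgebra, rfl, D.isLeftFiniteProjective, D.isGalois⟩,
      hreg⟩
  tfae_finish
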